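/- Conventions. Let $(R,\mathfrak m)$ be a regular local domain with $\dim R\ge 2$ and fraction field $K$. Models over $R$ are taken in the sense of Zariski and Samuel: a model is a set of local subrings of $K$ containing $R$ which is a finite union of affine models $\{A_P : P\in\operatorname{Spec}A\}$ of finitely generated $R$-subalgebras $A\subseteq K$ and is such that each valuation ring of $K$ containing $R$ dominates at most one of its members; it is complete if each such valuation ring dominates exactly one member, and normal if all its members are integrally closed. A morphism of models $X\to Y$ exists if each $T\in X$ dominates some (necessarily unique) $S\in Y$, and then sends $T$ to $S$; it is biregular at $S\in Y$ if its fibre over $S$ is $\{S\}$. A local quadratic transform of a local ring $(S,\mathfrak m_S)$ is a local ring on $\operatorname{Proj}S[\mathfrak m_S t]$ that dominates $S$. A regular local ring $S$ dominating $R$ is infinitely near to $R$ if $\dim S\ge 2$ and $S$ is obtained from $R$ by a finite (possibly empty) sequence of local quadratic transforms. It is a base point of an ideal $I$ of $R$ of height at least $2$ if the transform $I^S=a^{-1}IS$ is a proper ideal of $S$, where $aS$ is the smallest principal ideal of $S$ containing $IS$. The ideal $I$ is finitely supported if its set $\mathcal{BP}(I)$ of base points is finite; in that case, for $\Gamma=\mathcal{BP}(I)$,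 $X_\Gamma$ denotes the regular model obtained from $\operatorname{Spec}R$ by successively blowing up the maximal ideals of the points of $\Gamma$. For a regular local ring $S$ with fraction field $K$, $\operatorname{ord}_S$ denotes the discrete valuation (ring) of $K$ given by the powers of $\mathfrak m_S$. The set $\operatorname{Rees}I$ of Rees valuation rings of $I$ is the unique minimal finite set of discrete valuation rings $V$ with $R\subseteq V\subseteq K$ such that $\overline{I^n}=\bigcap_V I^nV\cap R$ for all $n$. Finally, $\overline{R[It]}$ is the integral closure of the Rees algebra $R[It]$, and an overring $B\subseteq K$ of a domain $A$ with fraction field $K$ is a sublocalization of $A$ if it is an intersection of localizations of $A$ at multiplicatively closed sets of nonzero elements. Theorem 3.10. Let $(R,\mathfrak m)$ be a regular local domain with $\dim R\ge 2$, let $I$ be a finitely supported $\mathfrak m$-primary ideal of $R$, and let $\Gamma=\mathcal{BP}(I)$. Let $Y$ be a normal complete model over $R$ such that there are morphisms of models $g:X_\Gamma\to Y$ and $h:Y\to\operatorname{Proj}\overline{R[It]}$ (so that $h\circ g$ is the morphism $f:X_\Gamma\to\operatorname{Proj}\overline{R[It]}$). If $\operatorname{ord}_{R_i}\in\operatorname{Rees}I$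 for each $R_i\in\Gamma$, then: 1. For each $S\in Y$ and each $T\in g^{-1}(S)$, the ring $T$ is a sublocalization of $S$. 2. The morphism $g:X_\Gamma\to Y$ is biregular at each $S\in Y$ that has torsion divisor class group. 3. If $S\in Y$ is not regular, then the divisor class group of $S$ is not a torsion group. -/

import Mathlib

open IsLocalRing

namespace ZariskiModel

/-! ### Models

A model over a subring `R` of a field `K` is a set of local subrings of `K`, in the sense of
Zariski and Samuel.  The order `S ≤ T` on `LocalSubring K` is domination: `S ⊆ T` and
`𝔪_T ∩ S = 𝔪_S`. -/

section Models

variable {K : Type*} [Field K]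

/-- The affine model of a subring `A` of `K`: all local rings `A_P`, for `P` a prime of `A`. -/
def affineModel (A : Subring K) : Set (LocalSubring K) :=
  {S | ∃ (P : Ideal A) (_ : P.IsPrime), S = LocalSubring.ofPrime A P}

/-- `M` is a model over `R`: a finite union of affine models of finitely generated
`R`-subalgebras of `K`, such that each valuation ring of `K` containing `R` dominates at most one
member of `M` (irredundance). -/
structure IsModel (R : Subring K) (M : Set (LocalSubring K)) : Prop where
  finite_union : ∃ F : Set (Subalgebra R K), F.Finite ∧ (∀ A ∈ F, A.FG) ∧
    M = ⋃ A ∈ F, affineModel A.toSubring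
  irredundant : ∀ V : ValuationSubring K, R ≤ V.toSubring →
    ∀ S ∈ M, ∀ T ∈ M, S ≤ V.toLocalSubring → T ≤ V.toLocalSubring → S = T

/-- A model is complete if each valuation ring of `K` containing `R` dominates a member of it. -/
structure IsCompleteModel (R : Subring K) (M : Set (LocalSubring K)) : Prop
    extends IsModel R M where
  complete : ∀ V : ValuationSubring K, R ≤ V.toSubring → ∃ S ∈ M, S ≤ V.toLocalSubring

/-- A model is normal if all its local rings are integrally closed. -/
def IsNormalModel (M : Set (LocalSubring K)) : Prop :=
  ∀ S ∈ M, IsIntegrallyClosed S.toSubring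

/-- There is a (birational) morphism of models `X → Y`: each `T ∈ X` dominates some `S ∈ Y`, its
image.  By irredundance of `Y` the image is unique. -/
def HasMorphism (X Y : Set (LocalSubring K)) : Prop :=
  ∀ T ∈ X, ∃ S ∈ Y, S ≤ T

/-- The fibre over `S` of the morphism from `X` to a model containing `S`. -/
def fiber (X : Set (LocalSubring K)) (S : LocalSubring K) : Set (LocalSubring K) :=
  {T | T ∈ X ∧ S ≤ T}

/-- The morphism from `X` to a model containing `S` is biregular at `S`. -/
def IsBiregularAt (X : Set (LocalSubring K)) (S : LocalSubring K) : Prop :=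
  fiber X S = {S}

/-! ### Blowups -/

/-- The chart `R[I/a]` of the blowup of `I`. -/
noncomputable def blowupChart (R : Subring K) (I : Ideal R) (a : R) : Subring K :=
  (Algebra.adjoin R {x : K | ∃ b ∈ I, x = (b : K) / (a : K)}).toSubring

/-- The blowup `Proj R[It]` of `I`, as a set of local rings. -/
def blowup (R : Subring K) (I : Ideal R) : Set (LocalSubring K) :=
  {S | ∃ a ∈ I, a ≠ 0 ∧ S ∈ affineModel (blowupChart R I a)}

/-- The normalized blowup, i.e. `Proj` of the integral closure of the Rees algebra `R[It]`, as a
set of local rings: its charts are the integral closures in `K` of the rings `R[I/a]`. -/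
def normalizedBlowup (R : Subring K) (I : Ideal R) : Set (LocalSubring K) :=
  {S | ∃ a ∈ I, a ≠ 0 ∧
    S ∈ affineModel (integralClosure (blowupChart R I a) K).toSubring}

/-! ### Infinitely near points, base points and the saturated regular model -/

/-- `T` is a local quadratic transform of `S`: a local ring on the blowup of the maximal ideal of
`S` that dominates `S`. -/
def IsLocalQuadraticTransform (S T : LocalSubring K) : Prop :=
  T ∈ blowup S.toSubring (maximalIdeal S.toSubring) ∧ S ≤ T

/-- `S` is infinitely near to `R`: it is a regular local ring of dimension at least two that
dominates `R` and is obtained from `R` by a finite (possibly empty) sequence of local quadratic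
transforms. -/
structure IsInfinitelyNear (R S : LocalSubring K) : Prop where
  regular : IsRegularLocalRing S.toSubring
  two_le_dim : 2 ≤ ringKrullDim S.toSubring
  dominates : R ≤ S
  chain : Relation.ReflTransGen IsLocalQuadraticTransform R S

/-- The extension `IS` of an ideal `I` of `R` to a larger subring `S` of `K`. -/
def extendIdeal {R : Subring K} (I : Ideal R) (S : Subring K) : Ideal S :=
  Ideal.span {s : S | ∃ r ∈ I, (r : K) = (s : K)}

/-- `aA` is the smallest principal ideal of `A` containing `J`. -/
def IsSmallestPrincipal {A : Type*} [CommRing A] (J : Ideal A) (a : A) : Prop :=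
  J ≤ Ideal.span {a} ∧ ∀ b : A, J ≤ Ideal.span {b} → Ideal.span {a} ≤ Ideal.span {b}

/-- The transform `a⁻¹ (IS)` of `I` in the unique factorization domain `S`, where `aS` is the
smallest principal ideal of `S` containing `IS`. -/
def idealTransform {R : Subring K} (I : Ideal R) (S : Subring K) : Ideal S :=
  Ideal.span {x : S | ∃ a : S, IsSmallestPrincipal (extendIdeal I S) a ∧
    a * x ∈ extendIdeal I S}

/-- The set of base points of `I`: the points infinitely near to `R` in which the transform of
`I` is a proper ideal. -/
def basePoints (R : LocalSubring K) (I : Ideal R.toSubring) : Set (LocalSubring K) :=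
  {S | IsInfinitelyNear R S ∧ idealTransform I S.toSubring ≠ ⊤}

/-- Blow up (the maximal ideals of) the points of `X` that belong to `Γ`: such a point is replaced
by its local quadratic transforms, and the other points of `X` are kept. -/
def blowupPoints (Γ X : Set (LocalSubring K)) : Set (LocalSubring K) :=
  {T | (T ∈ X ∧ T ∉ Γ) ∨ ∃ S ∈ X, S ∈ Γ ∧ IsLocalQuadraticTransform S T}

/-- The saturated regular model `X_Γ`: start from `Spec R` and successively blow up the points of
`Γ`.  For the finite set `Γ` of base points of a finitely supported ideal this sequence of models
becomes constant, and `X_Γ` is its eventual value. -/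
def saturatedModel (R : LocalSubring K) (Γ : Set (LocalSubring K)) : Set (LocalSubring K) :=
  {T | ∃ N : ℕ, ∀ n ≥ N, T ∈ (blowupPoints Γ)^[n] (affineModel R.toSubring)}

/-! ### Order valuations and Rees valuations -/

/-- The underlying set of the valuation ring of `ord_S`: the fractions `f / g` of elements of `S`
with `ord_S g ≤ ord_S f`, where `ord_S` is the order function of the powers of `𝔪_S`. -/
def ordRing (S : LocalSubring K) : Set K :=
  {x | ∃ f g : S.toSubring, g ≠ 0 ∧ x = (f : K) / (g : K) ∧
    ∀ n : ℕ, g ∈ maximalIdeal S.toSubring ^ n → f ∈ maximalIdeal S.toSubring ^ n}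

/-- `x` belongs to the integral closure of the ideal `J`. -/
def IsIntegralOverIdeal {A : Type*} [CommRing A] (J : Ideal A) (x : A) : Prop :=
  ∃ n : ℕ, 0 < n ∧ ∃ c : ℕ → A, (∀ i ∈ Finset.Icc 1 n, c i ∈ J ^ i) ∧
    x ^ n + ∑ i ∈ Finset.Icc 1 n, c i * x ^ (n - i) = 0

/-- `F` is a finite set of discrete valuation rings `V` with `R ⊆ V ⊆ K` such that, for all `n`,
the integral closure of `Iⁿ` is the intersection of the ideals `IⁿV ∩ R`. -/
structure DeterminesIntegralClosures (R : Subring K) (I : Ideal R)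
    (F : Set (ValuationSubring K)) : Prop where
  finite : F.Finite
  le : ∀ V ∈ F, R ≤ V.toSubring
  dvr : ∀ V ∈ F, IsDiscreteValuationRing V
  mem_iff : ∀ (n : ℕ) (x : R), IsIntegralOverIdeal (I ^ n) x ↔
    ∀ V ∈ F, ∃ y ∈ extendIdeal (I ^ n) V.toSubring, (y : K) = (x : K)

/-- The set `Rees I` of Rees valuation rings of `I`: the members of the (unique) minimal finite
set of discrete valuation rings that determines the integral closures of the powers of `I`. -/
def reesValuationRings (R : Subring K) (I : Ideal R) : Set (ValuationSubring K) :=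
  {V | ∃ F, Minimal (DeterminesIntegralClosures R I) F ∧ V ∈ F}

/-! ### Sublocalizations -/

/-- `B` is a sublocalization of `A`: an intersection of localizations of `A`. -/
def IsSublocalization (A B : Subring K) : Prop :=
  ∃ F : Set (Submonoid A), (∀ M ∈ F, (0 : A) ∉ M) ∧
    ∀ x : K, x ∈ B ↔ ∀ M ∈ F, ∃ a : A, ∃ s ∈ M, x = (a : K) / (s : K)

end Models

/-! ### The divisor class group of a normal Noetherian domain -/

section DivisorClassGroup

variable (A : Type*) [CommRing A]

/-- The height one primes of `A`. -/
def HeightOnePrime : Type _ := {P : PrimeSpectrum A // P.asIdeal.height = 1}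

variable {A}

/-- The order of `a ≠ 0` at the height one prime `P`: the largest `n` with `a ∈ Pⁿ A_P`. -/
noncomputable def ordAt (P : HeightOnePrime A) (a : A) : ℕ :=
  sSup {n : ℕ | algebraMap A (Localization.AtPrime P.1.asIdeal) a ∈
    maximalIdeal (Localization.AtPrime P.1.asIdeal) ^ n}

variable (A)

/-- The group of principal divisors `div (a / b)`, in the free abelian group on the height one
primes of `A`. -/
noncomputable def principalDivisors : AddSubgroup (HeightOnePrime A →₀ ℤ) :=
  AddSubgroup.closure {D | ∃ a b : A, a ≠ 0 ∧ b ≠ 0 ∧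
    ∀ P : HeightOnePrime A, D P = (ordAt P a : ℤ) - (ordAt P b : ℤ)}

/-- The divisor class group of `A`: divisors modulo principal divisors. -/
abbrev DivisorClassGroup : Type _ := (HeightOnePrime A →₀ ℤ) ⧸ principalDivisors A

/-- `A` has torsion divisor class group. -/
def HasTorsionDivisorClassGroup : Prop := IsAddTorsion (DivisorClassGroup A)

end DivisorClassGroup

end ZariskiModel

open ZariskiModel

/-!
A regular local ring is a normal domain, and for a regular local ring `S` with maximal ideal
`(z₁, …, zₙ)` the ring `S[z₁/zᵢ, …, zₙ/zᵢ]` is regular and `zᵢ` generates a prime ideal of it, with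
local ring `ord_S`.  So blowing up the maximal ideal of `S` creates only one new local ring of
dimension one, and a local ring of dimension one on `X_Γ` is a localization of `R` or one of the
rings `ord_{R_i}`.

The Rees valuation rings of `I` lie on every normal complete model `Y` which dominates the
normalized blowup of `I`: for an `x` with `x ∈ IⁿV` for all discrete valuation rings `V` on `Y` in
which `I` is proper, the fraction `x/aⁿ`, where `a` generates `I` locally on `Y`, has no poles on
`Y`, and so `x` is integral over `Iⁿ`.  Hence these `V` determine the integral closures of the
powers of `I`, and Rees' uniqueness theorem applies.

If every `ord_{R_i}` belongs to `Rees I`, the localizations of dimension one of a point `T` of `X_Γ`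
over `S ∈ Y` are therefore localizations of `S`, and the normal ring `T` is their intersection.
If a height one prime `P` of `S` were lost in `T`, and the class of `P` were torsion, then some
`c ∈ S` would have `P` as its only prime divisor, so that `c` would be a unit of `T` but not of
`S`, which is impossible as `T` dominates `S`.
-/

namespace ZariskiModel

/-! ### Regular local rings -/

section RegularLocalRing

open scoped Pointwise

variable {A : Type*} [CommRing A]

theorem spanFinrank_span_range_le {M ι : Type*} [AddCommGroup M] [Module A M] [Fintype ι]
    (y : ι → M) : (Submodule.span A (Set.range y)).spanFinrank ≤ Fintype.card ι :=
  (Submodule.spanFinrank_span_le_ncard_of_finite (Set.finite_range y)).trans <| by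
    rw [← Nat.card_eq_fintype_card, ← Set.ncard_univ, ← Set.image_univ]
    exact Set.ncard_image_le Set.finite_univ

theorem isLocalRing_quotient [IsLocalRing A] {J : Ideal A} (hJ : J ≤ maximalIdeal A) :
    IsLocalRing (A ⧸ J) :=
  have := Ideal.Quotient.nontrivial_iff.mpr fun h => maximalIdeal.isMaximal A |>.ne_top
    (top_le_iff.mp (h ▸ hJ))
  .of_surjective' _ Ideal.Quotient.mk_surjective

instance isLocalHom_mk [IsLocalRing A] {J : Ideal A} [Nontrivial (A ⧸ J)] :
    IsLocalHom (Ideal.Quotient.mk J) :=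
  .of_surjective _ Ideal.Quotient.mk_surjective

theorem exists_span_range_eq_maximalIdeal [IsRegularLocalRing A] {n : ℕ}
    (hn : ringKrullDim A = n) :
    ∃ y : Fin n → A, Ideal.span (Set.range y) = maximalIdeal A := by
  obtain ⟨s, hs, hspan⟩ :=
    Submodule.FG.exists_span_finset_card_eq_spanFinrank (IsNoetherian.noetherian (maximalIdeal A))
  have hcard : s.card = n := by
    rw [hs]
    exact_mod_cast (IsRegularLocalRing.spanFinrank_maximalIdeal (R := A)).trans hn
  refine ⟨fun i => (s.equivFinOfCardEq hcard).symm i, ?_⟩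
  rw [← hspan]
  exact congrArg _ (((s.equivFinOfCardEq hcard).symm.surjective.range_comp _).trans
    Subtype.range_coe)

theorem maximalIdeal_ne_bot_of_ringKrullDim_eq_succ [IsLocalRing A] {n : ℕ}
    (hn : ringKrullDim A = (n + 1 : ℕ)) :
    maximalIdeal A ≠ ⊥ := by
  intro h
  rw [ringKrullDim_eq_zero_of_isField (isField_iff_maximalIdeal_eq.mpr h)] at hn
  exact absurd (show 0 = n + 1 by exact_mod_cast hn) (by lia)

section Noetherian

variable [IsLocalRing A] [IsNoetherianRing A]

theorem isRegularLocalRing_of_span_range {n : ℕ} {y : Fin n → A}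
    (hy : Ideal.span (Set.range y) = maximalIdeal A) (hn : (n : WithBot ℕ∞) ≤ ringKrullDim A) :
    IsRegularLocalRing A := by
  refine .of_spanFinrank_maximalIdeal_le A (le_trans ?_ hn)
  rw [← hy]
  exact_mod_cast (spanFinrank_span_range_le y).trans_eq (Fintype.card_fin n)

theorem ringKrullDim_le_of_span_range {n : ℕ} {y : Fin n → A}
    (hy : Ideal.span (Set.range y) = maximalIdeal A) : ringKrullDim A ≤ n := by
  refine (ringKrullDim_le_spanFinrank_maximalIdeal A).trans ?_
  rw [← hy]
  exact_mod_cast (spanFinrank_span_range_le y).trans_eq (Fintype.card_fin n)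

variable (A) in
theorem exists_ringKrullDim_eq : ∃ n : ℕ, ringKrullDim A = n := by
  obtain ⟨d, hd⟩ := WithBot.ne_bot_iff_exists.mp (ringKrullDim_ne_bot (R := A))
  obtain ⟨n, rfl⟩ := ENat.ne_top_iff_exists.mp fun h : d = ⊤ =>
    ringKrullDim_ne_top (R := A) (by rw [← hd, h]; rfl)
  exact ⟨n, hd.symm⟩

theorem not_maximalIdeal_le_sq (hm : maximalIdeal A ≠ ⊥) :
    ¬ maximalIdeal A ≤ maximalIdeal A ^ 2 := by
  refine fun h => hm (Submodule.eq_bot_of_le_smul_of_le_jacobson_bot (maximalIdeal A) _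
    (IsNoetherian.noetherian _) ?_ (maximalIdeal_le_jacobson _))
  rwa [smul_eq_mul, ← pow_two]

theorem exists_mem_maximalIdeal_notMem_sq_of_finite (hm : maximalIdeal A ≠ ⊥) {s : Set (Ideal A)}
    (hs : s.Finite) (hp : ∀ P ∈ s, P.IsPrime) (hne : maximalIdeal A ∉ s) :
    ∃ x ∈ maximalIdeal A, x ∉ maximalIdeal A ^ 2 ∧ ∀ P ∈ s, x ∉ P := by
  classical
  by_contra! h
  -- Prime avoidance allows two of the ideals not to be prime; `𝔪 ^ 2` takes both places.
  have hcover : (maximalIdeal A : Set A) ⊆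
      ⋃ J ∈ ((insert (maximalIdeal A ^ 2) hs.toFinset : Finset (Ideal A)) : Set (Ideal A)),
        ((id J : Ideal A) : Set A) := by
    intro x hx
    rw [Set.mem_iUnion₂]
    by_cases hx2 : x ∈ maximalIdeal A ^ 2
    · exact ⟨_, by simp, hx2⟩
    · obtain ⟨P, hP, hxP⟩ := h x hx hx2
      exact ⟨P, by simp [hP], hxP⟩
  obtain ⟨J, hJ, hle⟩ := (Ideal.subset_union_prime (maximalIdeal A ^ 2) (maximalIdeal A ^ 2)
    fun J hJ hJne _ => hp J (by simpa [hJne] using hJ)).mp hcover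
  rcases Finset.mem_insert.mp hJ with rfl | hJ
  · exact not_maximalIdeal_le_sq hm hle
  · rw [Set.Finite.mem_toFinset] at hJ
    exact hne (le_antisymm hle (le_maximalIdeal (hp J hJ).ne_top) ▸ hJ)

theorem isRegularLocalRing_of_quotient {x : A} (hx : x ∈ nonZeroDivisors A)
    (hxm : x ∈ maximalIdeal A) [IsRegularLocalRing (A ⧸ Ideal.span {x})] :
    IsRegularLocalRing A := by
  obtain ⟨n, hn⟩ := exists_ringKrullDim_eq (A ⧸ Ideal.span {x})
  obtain ⟨y, hy⟩ := exists_span_range_eq_maximalIdeal hn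
  have hd := ringKrullDim_quotient_span_singleton_succ_eq_ringKrullDim_of_mem_nonZeroDivisors hx hxm
  choose z hz using fun i => Ideal.Quotient.mk_surjective (y i)
  refine isRegularLocalRing_of_span_range (n := n + 1) (y := Fin.cons x z) ?_ ?_
  · have hmap : (Ideal.span (Set.range z)).map (Ideal.Quotient.mk (Ideal.span {x})) =
        maximalIdeal (A ⧸ Ideal.span {x}) := by
      rw [Ideal.map_span, ← hy, ← Set.range_comp]
      exact congrArg _ (congrArg _ (funext hz))
    rw [Fin.range_cons, Ideal.span_insert, sup_comm,
      ← maximalIdeal_comap (Ideal.Quotient.mk (Ideal.span {x})), ← hmap,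
      Ideal.comap_map_of_surjective _ Ideal.Quotient.mk_surjective, ← RingHom.ker_eq_comap_bot,
      Ideal.mk_ker]
  · rw [← hd, hn]
    simp

end Noetherian

theorem eq_bot_of_le_span_singleton [IsLocalRing A] {P : Ideal A} [P.IsPrime] (hP : P.FG) {x : A}
    (hx : x ∈ maximalIdeal A) (hxP : x ∉ P) (hle : P ≤ Ideal.span {x}) : P = ⊥ := by
  refine Submodule.eq_bot_of_le_smul_of_le_jacobson_bot (Ideal.span {x}) _ hP (fun p hp => ?_)
    (((Ideal.span_singleton_le_iff_mem _).mpr hx).trans (maximalIdeal_le_jacobson _))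
  obtain ⟨c, rfl⟩ := Ideal.mem_span_singleton.mp (hle hp)
  exact Ideal.mul_mem_mul (Ideal.mem_span_singleton_self x)
    ((‹P.IsPrime›.mem_or_mem hp).resolve_left hxP)

section Regular

variable [IsRegularLocalRing A]

theorem isField_of_ringKrullDim_eq_zero (h : ringKrullDim A = 0) : IsField A := by
  obtain ⟨y, hy⟩ := exists_span_range_eq_maximalIdeal (n := 0) (A := A) (by simpa using h)
  rw [isField_iff_maximalIdeal_eq, ← hy, Set.range_eq_empty, Ideal.span_empty]

theorem exists_span_insert_eq_maximalIdeal {n : ℕ} (hn : ringKrullDim A = (n + 1 : ℕ)) {x : A}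
    (hx : x ∈ maximalIdeal A) (hx2 : x ∉ maximalIdeal A ^ 2) :
    ∃ y : Fin n → A, Ideal.span (insert x (Set.range y)) = maximalIdeal A := by
  obtain ⟨z, hz⟩ := exists_span_range_eq_maximalIdeal hn
  have hzm : ∀ i, z i ∈ maximalIdeal A := fun i => hz ▸ Ideal.subset_span ⟨i, rfl⟩
  obtain ⟨c, rfl⟩ := Ideal.mem_span_range_iff_exists_fun.mp (hz ▸ hx)
  obtain ⟨k, hk⟩ : ∃ k, IsUnit (c k) := by
    by_contra! h
    rw [pow_two] at hx2
    exact hx2 (Ideal.sum_mem _ fun i _ => Ideal.mul_mem_mul (h i) (hzm i))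
  set x := ∑ i, c i * z i with hxdef
  let J := Ideal.span (insert x (Set.range fun j => z (k.succAbove j)))
  have hzJ : ∀ j, z (k.succAbove j) ∈ J := fun j => Ideal.subset_span (.inr ⟨j, rfl⟩)
  have hzkJ : z k ∈ J := by
    rw [Fin.sum_univ_succAbove _ k, ← sub_eq_iff_eq_add] at hxdef
    rw [← Ideal.unit_mul_mem_iff_mem J hk, ← hxdef]
    exact J.sub_mem (Ideal.subset_span (.inl rfl))
      (J.sum_mem fun j _ => J.mul_mem_left _ (hzJ j))
  refine ⟨fun j => z (k.succAbove j), le_antisymm ?_ ?_⟩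
  · rw [Ideal.span_le, Set.insert_subset_iff]
    exact ⟨hx, Set.range_subset_iff.mpr fun j => hzm _⟩
  · rw [← hz, Ideal.span_le, Set.range_subset_iff]
    intro i
    rcases Fin.eq_self_or_eq_succAbove k i with rfl | ⟨j, rfl⟩
    exacts [hzkJ, hzJ j]

theorem isRegularLocalRing_quotient {n : ℕ} (hn : ringKrullDim A = (n + 1 : ℕ)) {x : A}
    (hx : x ∈ maximalIdeal A) (hx2 : x ∉ maximalIdeal A ^ 2) :
    IsRegularLocalRing (A ⧸ Ideal.span {x}) ∧ ringKrullDim (A ⧸ Ideal.span {x}) = n := by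
  obtain ⟨y, hy⟩ := exists_span_insert_eq_maximalIdeal hn hx hx2
  have := isLocalRing_quotient ((Ideal.span_singleton_le_iff_mem _).mpr hx)
  have hm : Ideal.span (Set.range (Ideal.Quotient.mk (Ideal.span {x}) ∘ y)) =
      maximalIdeal (A ⧸ Ideal.span {x}) := by
    rw [← map_maximalIdeal_of_surjective _ Ideal.Quotient.mk_surjective, ← hy, Ideal.map_span,
      Set.image_insert_eq, Ideal.Quotient.eq_zero_iff_mem.mpr (Ideal.mem_span_singleton_self x),
      Ideal.span_insert, Ideal.span_singleton_zero, bot_sup_eq, Set.range_comp]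
  have hdim : (n : WithBot ℕ∞) ≤ ringKrullDim (A ⧸ Ideal.span {x}) := by
    have hle := ringKrullDim_le_ringKrullDim_quotSMulTop_succ hx
    have hspan : x • (⊤ : Ideal A) = Ideal.span {x} := by
      rw [← Submodule.ideal_span_singleton_smul, smul_eq_mul, Ideal.mul_top]
    rw [ringKrullDim_eq_of_ringEquiv (Ideal.quotientEquivAlgOfEq A hspan).toRingEquiv, hn] at hle
    obtain ⟨k, hk⟩ := exists_ringKrullDim_eq (A ⧸ Ideal.span {x})
    rw [hk] at hle ⊢
    exact_mod_cast Nat.le_of_succ_le_succ (show n + 1 ≤ k + 1 by exact_mod_cast hle)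
  exact ⟨isRegularLocalRing_of_span_range hm hdim,
    le_antisymm (ringKrullDim_le_of_span_range hm) hdim⟩

end Regular

theorem isDomain_of_isRegularLocalRing [IsRegularLocalRing A] : IsDomain A := by
  obtain ⟨n, hn⟩ := exists_ringKrullDim_eq A
  induction n generalizing A with
  | zero => exact (isField_of_ringKrullDim_eq_zero (by simpa using hn)).isDomain
  | succ n ih =>
    have hmin : maximalIdeal A ∉ minimalPrimes A := fun h => by
      have hdim := maximalIdeal_height_eq_ringKrullDim (R := A)
      rw [Ideal.height_eq_zero_iff.mpr h, hn] at hdim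
      exact absurd (show 0 = n + 1 by exact_mod_cast hdim) (by lia)
    -- `x` generates a prime ideal which contains a minimal prime `P`, and `x ∉ P`.
    obtain ⟨x, hx, hx2, hxmin⟩ := exists_mem_maximalIdeal_notMem_sq_of_finite
      (maximalIdeal_ne_bot_of_ringKrullDim_eq_succ hn)
      (minimalPrimes.finite_of_isNoetherianRing A) (fun P hP => hP.1.1) hmin
    obtain ⟨_, hd⟩ := isRegularLocalRing_quotient hn hx hx2
    have hprime : (Ideal.span {x}).IsPrime := (Ideal.Quotient.isDomain_iff_prime _).mp (ih hd)
    obtain ⟨P, hP, hPx⟩ := Ideal.exists_minimalPrimes_le (bot_le (a := Ideal.span {x}))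
    have : P.IsPrime := hP.1.1
    obtain rfl := eq_bot_of_le_span_singleton (IsNoetherian.noetherian P) hx (hxmin P hP) hPx
    have := (Ideal.Quotient.isDomain_iff_prime (⊥ : Ideal A)).mpr ‹_›
    exact (RingEquiv.quotientBot A).symm.toMulEquiv.isDomain

end RegularLocalRing

/-! ### Projective dimension and regularity of localizations -/

section ProjectiveDimension

open CategoryTheory TensorProduct

open scoped Pointwise

universe u

/-- `M` has projective dimension at most `n` over `A`: the unbundled form of
`CategoryTheory.HasProjectiveDimensionLE`. -/
abbrev PdLE (A : Type u) [CommRing A] (M : Type u) [AddCommGroup M] [Module A M] (n : ℕ) : Prop :=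
  HasProjectiveDimensionLE (ModuleCat.of A M) n

variable {A : Type u} [CommRing A] {M : Type u} [AddCommGroup M] [Module A M]

theorem pdLE_zero_iff : PdLE A M 0 ↔ Module.Projective A M := by
  rw [PdLE, ← projective_iff_hasProjectiveDimensionLE_zero, ← IsProjective.iff_projective]

theorem pdLE_succ_iff {P : Type u} [AddCommGroup P] [Module A P] [Module.Projective A P]
    {f : P →ₗ[A] M} (hf : Function.Surjective f) {n : ℕ} :
    PdLE A M (n + 1) ↔ PdLE A (LinearMap.ker f) n :=
  (LinearMap.shortExact_shortComplexKer hf).hasProjectiveDimensionLT_X₃_iff n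
    ((IsProjective.iff_projective (R := A) (P := P)).mp inferInstance)

theorem PdLE.mono {n m : ℕ} (h : PdLE A M n) (hnm : n ≤ m) : PdLE A M m :=
  have := h
  hasProjectiveDimensionLT_of_ge _ (n + 1) (m + 1) (by lia)

theorem PdLE.retract {N : Type u} [AddCommGroup N] [Module A N] {n : ℕ} (h : PdLE A N n)
    (i : M →ₗ[A] N) (r : N →ₗ[A] M) (hri : r ∘ₗ i = LinearMap.id) : PdLE A M n :=
  have := h
  Retract.hasProjectiveDimensionLT (Y := ModuleCat.of A N)
    { i := ModuleCat.ofHom i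
      r := ModuleCat.ofHom r
      retract := by rw [← ModuleCat.ofHom_comp, hri]; rfl } (n + 1)

theorem pdLE_congr {N : Type u} [AddCommGroup N] [Module A N] (e : M ≃ₗ[A] N) {n : ℕ} :
    PdLE A M n ↔ PdLE A N n :=
  ⟨fun h => h.retract e.symm e (by ext; simp), fun h => h.retract e e.symm (by ext; simp)⟩

/-- The map of `A ⧸ (x)`-modules `M ⧸ x M → N ⧸ x N` induced by `f : M → N`; Mathlib's
`QuotSMulTop.map` is only `A`-linear. -/
def quotSMulTopMap (x : A) {N : Type u} [AddCommGroup N] [Module A N] (f : M →ₗ[A] N) :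
    QuotSMulTop x M →ₗ[A ⧸ Ideal.span {x}] QuotSMulTop x N :=
  (QuotSMulTop.map x f).extendScalarsOfSurjective Ideal.Quotient.mk_surjective

theorem nonempty_quotSMulTop_ker_equiv {P : Type u} [AddCommGroup P] [Module A P] {x : A}
    (hM : IsSMulRegular M x) {f : P →ₗ[A] M} (hf : Function.Surjective f) :
    Nonempty (QuotSMulTop x (LinearMap.ker f) ≃ₗ[A ⧸ Ideal.span {x}]
      LinearMap.ker (quotSMulTopMap x f)) := by
  let ι := quotSMulTopMap x (LinearMap.ker f).subtype
  have hexact : Function.Exact ι (quotSMulTopMap x f) :=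
    QuotSMulTop.map_exact x (LinearMap.exact_subtype_ker_map f) hf
  have hinj : Function.Injective ι := by
    have h := QuotSMulTop.map_first_exact_on_four_term_exact_of_isSMulRegular_last
      (f₁ := (0 : LinearMap.ker f →ₗ[A] LinearMap.ker f))
      ((LinearMap.exact_zero_iff_injective _ _).mpr (LinearMap.ker f).injective_subtype)
      (LinearMap.exact_subtype_ker_map f) hM
    rw [map_zero] at h
    exact (LinearMap.exact_zero_iff_injective _ _).mp h
  exact ⟨LinearEquiv.ofInjective ι hinj ≪≫ₗ
    LinearEquiv.ofEq _ _ (LinearMap.exact_iff.mp hexact).symm⟩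

section Local

variable [IsLocalRing A]

theorem exists_surjective_forall_mem_maximalIdeal (M : Type u) [AddCommGroup M] [Module A M]
    [Module.Finite A M] :
    ∃ (ι : Type u) (_ : Finite ι) (f : (ι →₀ A) →ₗ[A] M), Function.Surjective f ∧
      ∀ c ∈ LinearMap.ker f, ∀ i, c i ∈ maximalIdeal A := by
  let w := Module.Free.chooseBasis (ResidueField A) (ResidueField A ⊗[A] M)
  obtain ⟨v, hv⟩ := (TensorProduct.mk_surjective A M (ResidueField A)
    residue_surjective).comp_left w
  have hv (i) : 1 ⊗ₜ v i = w i := congrFun hv i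
  have hterm (a : A) (i) : (1 : ResidueField A) ⊗ₜ[A] (a • v i) = residue A a • w i := by
    rw [tmul_smul, hv]
    exact (algebraMap_smul (ResidueField A) a (w i)).symm
  refine ⟨_, inferInstance, Finsupp.linearCombination A v, ?_, fun c hc i => ?_⟩
  · rw [← LinearMap.range_eq_top, Finsupp.range_linearCombination]
    exact span_eq_top_of_tmul_eq_basis v w hv
  · have hsum : c.sum (fun i a => residue A a • w i) = 0 := by
      have h := congrArg (TensorProduct.mk A (ResidueField A) M 1) (LinearMap.mem_ker.mp hc)
      rw [Finsupp.linearCombination_apply, map_finsuppSum, map_zero] at h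
      simpa only [mk_apply, hterm] using h
    rw [← residue_eq_zero_iff]
    by_cases hi : i ∈ c.support
    · exact linearIndependent_iff'.mp w.linearIndependent c.support _ hsum i hi
    · rw [Finsupp.notMem_support_iff.mp hi, map_zero]

variable [IsNoetherianRing A]

theorem projective_quotSMulTop_iff [Module.Finite A M] {x : A} (hx : x ∈ maximalIdeal A)
    (hM : IsSMulRegular M x) :
    Module.Projective (A ⧸ Ideal.span {x}) (QuotSMulTop x M) ↔ Module.Projective A M := by
  have := isLocalRing_quotient ((Ideal.span_singleton_le_iff_mem _).mpr hx)
  have := Module.finitePresentation_of_finite A M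
  have := Module.Finite.of_restrictScalars_finite A (A ⧸ Ideal.span {x}) (QuotSMulTop x M)
  have hfree := Module.free_quotSMulTop_iff_free A M (maximalIdeal_le_jacobson _ hx) hM
  refine ⟨fun _ => ?_, fun _ => ?_⟩
  · have := hfree.mp Module.free_of_flat_of_isLocalRing
    infer_instance
  · have := hfree.mpr Module.free_of_flat_of_isLocalRing
    infer_instance

theorem pdLE_quotSMulTop_iff {x : A} (hx : x ∈ maximalIdeal A) (hA : IsSMulRegular A x)
    [Module.Finite A M] (hM : IsSMulRegular M x) {n : ℕ} :
    PdLE (A ⧸ Ideal.span {x}) (QuotSMulTop x M) n ↔ PdLE A M n := by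
  induction n generalizing M with
  | zero => rw [pdLE_zero_iff, pdLE_zero_iff, projective_quotSMulTop_iff hx hM]
  | succ n ih =>
    obtain ⟨P, _, _, _, _, f, hf⟩ := Module.exists_finite_presentation.{u} A M
    have hker : IsSMulRegular (LinearMap.ker f) x :=
      .submodule _ _ <| ((TensorProduct.rid A P).isSMulRegular_congr x).mp (hA.lTensor P)
    obtain ⟨e⟩ := nonempty_quotSMulTop_ker_equiv hM hf
    rw [pdLE_succ_iff hf, pdLE_succ_iff (f := quotSMulTopMap x f) (QuotSMulTop.map_surjective x hf),
      ← ih hker, pdLE_congr e]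

theorem free_of_pdLE_of_forall_mul_eq_zero {s : A} (hs0 : s ≠ 0)
    (hs : ∀ a ∈ maximalIdeal A, s * a = 0) {n : ℕ} (M : Type u) [AddCommGroup M] [Module A M]
    [Module.Finite A M] (h : PdLE A M n) : Module.Free A M := by
  induction n generalizing M with
  | zero =>
    rw [pdLE_zero_iff] at h
    exact Module.free_of_flat_of_isLocalRing
  | succ n ih =>
    obtain ⟨ι, _, f, hf, hker⟩ := exists_surjective_forall_mem_maximalIdeal (A := A) M
    have := ih _ ((pdLE_succ_iff hf).mp h)
    have hbot : LinearMap.ker f = ⊥ := by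
      -- The entries of the elements of `ker f` lie in `𝔪`, so that `s` annihilates `ker f`.
      by_contra hne
      have := Submodule.nontrivial_iff_ne_bot.mpr hne
      exact hs0 (eq_of_smul_eq_smul fun c : LinearMap.ker f => by
        rw [zero_smul]
        exact Subtype.ext (Finsupp.ext fun i => hs _ (hker c c.2 i)))
    exact .of_equiv (LinearEquiv.ofBijective f ⟨LinearMap.ker_eq_bot.mp hbot, hf⟩)

end Local

theorem pdLE_of_isRegularLocalRing [IsRegularLocalRing A] {n : ℕ} (hn : ringKrullDim A = n)
    (M : Type u) [AddCommGroup M] [Module A M] [Module.Finite A M] : PdLE A M n := by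
  induction n generalizing A M with
  | zero =>
    let := (isField_of_ringKrullDim_eq_zero (A := A) (by simpa using hn)).toField
    rw [pdLE_zero_iff]
    infer_instance
  | succ n ih =>
    have := isDomain_of_isRegularLocalRing (A := A)
    obtain ⟨x, hx, hx2⟩ := SetLike.not_le_iff_exists.mp
      (not_maximalIdeal_le_sq (maximalIdeal_ne_bot_of_ringKrullDim_eq_succ hn))
    have hx0 : x ≠ 0 := fun h => hx2 (h ▸ zero_mem _)
    obtain ⟨_, hdim⟩ := isRegularLocalRing_quotient hn hx hx2
    obtain ⟨P, _, _, _, _, f, hf⟩ := Module.exists_finite_presentation.{u} A M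
    have := Module.Finite.of_restrictScalars_finite A (A ⧸ Ideal.span {x})
      (QuotSMulTop x (LinearMap.ker f))
    rw [pdLE_succ_iff hf, ← pdLE_quotSMulTop_iff hx (.of_ne_zero hx0) (.of_ne_zero hx0)]
    exact ih hdim _

end ProjectiveDimension

section Serre

open scoped Pointwise

universe u

variable {A : Type u} [CommRing A]

theorem PdLE.quotient_of_apply_eq_one {J : Ideal A} {Q : Type u} [AddCommGroup Q] [Module A Q]
    {n : ℕ} (h : PdLE A Q n) {q : Q} (hq : ∀ a ∈ J, a • q = 0) {r : Q →ₗ[A] A ⧸ J}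
    (hr : r q = 1) : PdLE A (A ⧸ J) n := by
  refine h.retract (Submodule.liftQ J (LinearMap.toSpanSingleton A Q q) fun a ha => ?_) r ?_
  · rw [LinearMap.mem_ker, LinearMap.toSpanSingleton_apply, hq a ha]
  · refine Submodule.linearMap_qext _ (LinearMap.ext_ring ?_)
    rw [LinearMap.comp_assoc, Submodule.liftQ_mkQ, LinearMap.comp_apply,
      LinearMap.toSpanSingleton_apply, one_smul, hr]
    rfl

variable [IsLocalRing A]

theorem exists_linearMap_apply_eq_one {x : A} (hx : x ∈ maximalIdeal A)
    (hx2 : x ∉ maximalIdeal A ^ 2) :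
    ∃ φ : maximalIdeal A →ₗ[A] ResidueField A, φ ⟨x, hx⟩ = 1 := by
  have hne : (maximalIdeal A).toCotangent ⟨x, hx⟩ ≠ 0 := by
    rwa [Ne, Ideal.toCotangent_eq_zero]
  obtain ⟨ψ, hψ⟩ := Module.Projective.exists_dual_eq_one (ResidueField A)
    (V := CotangentSpace A) hne
  exact ⟨ψ.restrictScalars A ∘ₗ (maximalIdeal A).toCotangent, hψ⟩

theorem exists_quotSMulTop_linearMap_apply_eq_one {x : A} (hx : x ∈ maximalIdeal A)
    (hx2 : x ∉ maximalIdeal A ^ 2) [IsLocalRing (A ⧸ Ideal.span {x})] :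
    ∃ r : QuotSMulTop x (maximalIdeal A) →ₗ[A ⧸ Ideal.span {x}]
      ((A ⧸ Ideal.span {x}) ⧸ maximalIdeal (A ⧸ Ideal.span {x})),
      r (Submodule.Quotient.mk ⟨x, hx⟩) = 1 := by
  obtain ⟨φ, hφ⟩ := exists_linearMap_apply_eq_one hx hx2
  let q : ResidueField A →ₗ[A] ((A ⧸ Ideal.span {x}) ⧸ maximalIdeal (A ⧸ Ideal.span {x})) :=
    Submodule.liftQ (maximalIdeal A) (Algebra.linearMap A _) fun a ha =>
      Ideal.Quotient.eq_zero_iff_mem.mpr (by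
        rwa [← maximalIdeal_comap (Ideal.Quotient.mk (Ideal.span {x})), Ideal.mem_comap] at ha)
  have hq : q 1 = 1 := (Submodule.liftQ_apply _ _ (1 : A)).trans (map_one (algebraMap A _))
  have hker : x • (⊤ : Submodule A (maximalIdeal A)) ≤ LinearMap.ker (q ∘ₗ φ) := by
    rintro _ ⟨b, -, rfl⟩
    have hx0 : algebraMap A (A ⧸ Ideal.span {x}) x = 0 :=
      Ideal.Quotient.eq_zero_iff_mem.mpr (Ideal.mem_span_singleton_self x)
    rw [DistribSMul.toLinearMap_apply, LinearMap.mem_ker, map_smul,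
      ← algebraMap_smul (A ⧸ Ideal.span {x}) x, hx0, zero_smul]
  exact ⟨(Submodule.liftQ _ (q ∘ₗ φ) hker).extendScalarsOfSurjective Ideal.Quotient.mk_surjective,
    (congrArg q hφ).trans hq⟩

variable [IsNoetherianRing A]

theorem PdLE.quotient_maximalIdeal_quotient {x : A} (hx : x ∈ maximalIdeal A)
    (hx2 : x ∉ maximalIdeal A ^ 2) (hreg : IsSMulRegular A x) [IsLocalRing (A ⧸ Ideal.span {x})]
    {n : ℕ} (h : PdLE A (A ⧸ maximalIdeal A) n) :
    PdLE (A ⧸ Ideal.span {x})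
      ((A ⧸ Ideal.span {x}) ⧸ maximalIdeal (A ⧸ Ideal.span {x})) n := by
  have hm : PdLE A (maximalIdeal A) n := by
    rw [← pdLE_congr (LinearEquiv.ofEq _ _ (Submodule.ker_mkQ (maximalIdeal A))),
      ← pdLE_succ_iff (Submodule.mkQ_surjective _)]
    exact h.mono (Nat.le_succ n)
  -- `k` is the retract of `𝔪 ⧸ x 𝔪` generated by the class of `x`.
  obtain ⟨r, hr⟩ := exists_quotSMulTop_linearMap_apply_eq_one hx hx2
  refine ((pdLE_quotSMulTop_iff hx hreg (hreg.submodule _ _)).mpr hm).quotient_of_apply_eq_one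
    (fun b hb => ?_) hr
  obtain ⟨a, rfl⟩ := Ideal.Quotient.mk_surjective b
  have ha : a ∈ maximalIdeal A := by rwa [← maximalIdeal_comap (Ideal.Quotient.mk (Ideal.span {x}))]
  refine (algebraMap_smul (A ⧸ Ideal.span {x}) a _).trans ?_
  rw [← Submodule.Quotient.mk_smul, Submodule.Quotient.mk_eq_zero]
  exact (Submodule.mem_smul_pointwise_iff_exists _ _ _).mpr
    ⟨⟨a, ha⟩, trivial, Subtype.ext (mul_comm x a)⟩

theorem maximalIdeal_eq_bot_of_mem_associatedPrimes {n : ℕ} (h : PdLE A (A ⧸ maximalIdeal A) n)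
    (hass : maximalIdeal A ∈ associatedPrimes A A) : maximalIdeal A = ⊥ := by
  obtain ⟨-, s, hs⟩ := isAssociatedPrime_iff.mp hass
  have hmem (a : A) : a ∈ maximalIdeal A ↔ a * s = 0 := by
    rw [hs, Submodule.mem_colon_singleton, Submodule.mem_bot, smul_eq_mul]
  have hs0 : s ≠ 0 := by
    rintro rfl
    exact (Ideal.ne_top_iff_one _).mp (maximalIdeal.isMaximal A).ne_top ((hmem 1).mpr (mul_zero 1))
  have hfree := free_of_pdLE_of_forall_mul_eq_zero hs0
    (fun a ha => by rw [mul_comm, (hmem a).mp ha]) _ h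
  have := Ideal.Quotient.nontrivial_iff.mpr (maximalIdeal.isMaximal A).ne_top
  refine (Submodule.eq_bot_iff _).mpr fun a ha =>
    eq_of_smul_eq_smul fun c : A ⧸ maximalIdeal A => ?_
  rw [zero_smul, ← algebraMap_smul (A ⧸ maximalIdeal A), Ideal.Quotient.algebraMap_eq,
    Ideal.Quotient.eq_zero_iff_mem.mpr ha, zero_smul]

theorem exists_mem_nonZeroDivisors_notMem_sq (hass : maximalIdeal A ∉ associatedPrimes A A) :
    ∃ x ∈ maximalIdeal A, x ∉ maximalIdeal A ^ 2 ∧ x ∈ nonZeroDivisors A := by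
  have hm : maximalIdeal A ≠ ⊥ := by
    intro hm
    refine hass (isAssociatedPrime_iff.mpr ⟨inferInstance, 1, ?_⟩)
    rw [hm]
    ext a
    rw [Submodule.mem_colon_singleton, smul_eq_mul, mul_one]
  obtain ⟨x, hx, hx2, hxP⟩ := exists_mem_maximalIdeal_notMem_sq_of_finite hm
    (associatedPrimes.finite A A) (fun P hP => hP.1) hass
  refine ⟨x, hx, hx2, by_contra fun hx0 => ?_⟩
  have hmem : x ∈ (nonZeroDivisors A : Set A)ᶜ := hx0
  rw [← biUnion_associatedPrimes_eq_compl_nonZeroDivisors] at hmem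
  obtain ⟨P, hP, hxP'⟩ := Set.mem_iUnion₂.mp hmem
  exact hxP P hP hxP'

theorem isRegularLocalRing_of_pdLE {n : ℕ} (h : PdLE A (A ⧸ maximalIdeal A) n) :
    IsRegularLocalRing A := by
  obtain ⟨d, hd⟩ := exists_ringKrullDim_eq A
  induction d using Nat.strong_induction_on generalizing A with
  | _ d ih =>
  by_cases hass : maximalIdeal A ∈ associatedPrimes A A
  · let := (isField_iff_maximalIdeal_eq.mpr
      (maximalIdeal_eq_bot_of_mem_associatedPrimes h hass)).toField
    infer_instance
  · obtain ⟨x, hx, hx2, hx0⟩ := exists_mem_nonZeroDivisors_notMem_sq hass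
    have := isLocalRing_quotient ((Ideal.span_singleton_le_iff_mem _).mpr hx)
    obtain ⟨e, he⟩ := exists_ringKrullDim_eq (A ⧸ Ideal.span {x})
    have hdim := ringKrullDim_quotient_span_singleton_succ_eq_ringKrullDim_of_mem_nonZeroDivisors
      hx0 hx
    rw [hd, he] at hdim
    have hed : e + 1 = d := by exact_mod_cast hdim
    have hreg : IsSMulRegular A x := Module.Flat.isSMulRegular_of_nonZeroDivisors hx0
    have := ih e (by lia) (h.quotient_maximalIdeal_quotient hx hx2 hreg) he
    exact isRegularLocalRing_of_quotient hx0 hx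

end Serre

section Localization

theorem ringKrullDim_localization_lt {A : Type*} [CommRing A] [IsLocalRing A] [IsNoetherianRing A]
    {P : Ideal A} [P.IsPrime] (hP : P ≠ maximalIdeal A) :
    ringKrullDim (Localization.AtPrime P) < ringKrullDim A := by
  rw [IsLocalization.AtPrime.ringKrullDim_eq_height P, ← maximalIdeal_height_eq_ringKrullDim]
  exact_mod_cast Ideal.height_strict_mono_of_isPrime
    (lt_of_le_of_ne (le_maximalIdeal ‹P.IsPrime›.ne_top) hP)

section IntegrallyClosed

variable {A : Type*} [CommRing A]

theorem mem_radical_of_isIntegral_of_eq_mul {B : Type*} [CommRing B] [Algebra A B]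
    [FaithfulSMul A B] {x g : A} {f : B} (hf : IsIntegral A f)
    (hg : algebraMap A B g = algebraMap A B x * f) : g ∈ (Ideal.span {x}).radical := by
  obtain ⟨p, hp, hpf⟩ := hf
  have hroot : Polynomial.eval g (p.scaleRoots x) = 0 := by
    apply FaithfulSMul.algebraMap_injective A B
    rw [map_zero, ← Polynomial.aeval_algebraMap_apply_eq_algebraMap_eval, hg]
    exact Polynomial.scaleRoots_aeval_eq_zero hpf
  rw [Polynomial.eval_eq_sum_range, Polynomial.natDegree_scaleRoots, Finset.sum_range_succ,
    Polynomial.coeff_scaleRoots_natDegree, hp.leadingCoeff, one_mul, add_comm] at hroot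
  refine ⟨p.natDegree, ?_⟩
  rw [eq_neg_of_add_eq_zero_left hroot]
  refine neg_mem (Ideal.sum_mem _ fun i hi => Ideal.mul_mem_right _ _ ?_)
  rw [Polynomial.coeff_scaleRoots]
  exact Ideal.mul_mem_left _ _ (Ideal.pow_mem_of_mem _ (Ideal.mem_span_singleton_self x) _
    (Nat.sub_pos_of_lt (Finset.mem_range.mp hi)))

variable {K : Type*} [Field K] [Algebra A K]

theorem mem_range_of_isIntegral_of_mul_mem_range [IsFractionRing A K] {x : A} (hx : Prime x) {f : K}
    (hf : IsIntegral A f) (h : algebraMap A K x * f ∈ (algebraMap A K).range) :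
    f ∈ (algebraMap A K).range := by
  obtain ⟨g, hg⟩ := h
  have hgx := mem_radical_of_isIntegral_of_eq_mul hf hg
  rw [((Ideal.span_singleton_prime hx.ne_zero).mpr hx).radical, Ideal.mem_span_singleton] at hgx
  obtain ⟨c, rfl⟩ := hgx
  rw [map_mul] at hg
  have hx0 : algebraMap A K x ≠ 0 := by
    rw [Ne, FaithfulSMul.algebraMap_eq_zero_iff]
    exact hx.ne_zero
  exact ⟨c, mul_left_cancel₀ hx0 hg⟩

theorem exists_pow_mul_mem_range {x : A} {f : K}
    (h : ∀ (P : Ideal A) [P.IsPrime], x ∉ P →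
      ∃ s ∉ P, algebraMap A K s * f ∈ (algebraMap A K).range) :
    ∃ n : ℕ, algebraMap A K (x ^ n) * f ∈ (algebraMap A K).range := by
  let D : Ideal A := Submodule.comap (LinearMap.toSpanSingleton A K f)
    (LinearMap.range (Algebra.linearMap A K))
  have hD (r : A) : r ∈ D ↔ algebraMap A K r * f ∈ (algebraMap A K).range := by
    simp [D, Algebra.smul_def]
  simp only [← hD] at h ⊢
  change x ∈ D.radical
  rw [Ideal.radical_eq_sInf, Submodule.mem_sInf]
  rintro P ⟨hDP, hP⟩
  by_contra hxP
  obtain ⟨s, hsP, hsD⟩ := h P hxP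
  exact hsP (hDP hsD)

theorem isIntegrallyClosed_of_forall_localization [IsDomain A] {x : A} (hx : Prime x)
    (h : ∀ (P : Ideal A) [P.IsPrime], x ∉ P → IsIntegrallyClosed (Localization.AtPrime P)) :
    IsIntegrallyClosed A := by
  let K := FractionRing A
  refine (isIntegrallyClosed_iff K).mpr fun {f} hf => ?_
  obtain ⟨n, hn⟩ := exists_pow_mul_mem_range (x := x) (f := f) fun P _ hxP => by
    have hclosed := h P hxP
    have := IsFractionRing.isFractionRing_of_isDomain_of_isLocalization P.primeCompl
      (Localization.AtPrime P) K
    obtain ⟨g, rfl⟩ := (isIntegrallyClosed_iff K).mp hclosed hf.tower_top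
    obtain ⟨a, s, rfl⟩ := IsLocalization.exists_mk'_eq P.primeCompl g
    refine ⟨s, s.2, a, ?_⟩
    rw [IsScalarTower.algebraMap_apply A (Localization.AtPrime P) K,
      IsScalarTower.algebraMap_apply A (Localization.AtPrime P) K, ← map_mul, mul_comm,
      IsLocalization.mk'_spec]
  induction n with
  | zero => simpa using hn
  | succ n ih =>
    refine ih (mem_range_of_isIntegral_of_mul_mem_range hx
      ((isIntegral_algebraMap (x := x ^ n)).mul hf) ?_)
    rwa [← mul_assoc, ← map_mul, ← pow_succ']

end IntegrallyClosed

universe u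

variable {A : Type u} [CommRing A] [IsRegularLocalRing A]

theorem isRegularLocalRing_localization (P : Ideal A) [P.IsPrime] :
    IsRegularLocalRing (Localization.AtPrime P) := by
  obtain ⟨n, hn⟩ := exists_ringKrullDim_eq A
  let AP := Localization.AtPrime P
  let PAP : Ideal AP := Submodule.localized' AP P.primeCompl (Algebra.linearMap A AP) P
  have hPAP : PAP = maximalIdeal AP :=
    (Ideal.localized'_eq_map AP P.primeCompl P).trans Localization.AtPrime.map_eq_maximalIdeal
  let e : LocalizedModule P.primeCompl (A ⧸ P) ≃ₗ[A] AP ⧸ PAP :=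
    IsLocalizedModule.linearEquiv P.primeCompl (LocalizedModule.mkLinearMap P.primeCompl (A ⧸ P))
      (Submodule.toLocalizedQuotient' AP P.primeCompl (Algebra.linearMap A AP) P)
  have : CategoryTheory.HasProjectiveDimensionLE (ModuleCat.of A (A ⧸ P)) n :=
    pdLE_of_isRegularLocalRing hn _
  let e' := e.extendScalarsOfIsLocalization P.primeCompl AP
  have hloc : PdLE AP (AP ⧸ PAP) n :=
    (pdLE_congr ((Shrink.linearEquiv _ _).trans e')).mp
      (ModuleCat.localizedModule_hasProjectiveDimensionLE n P.primeCompl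
        (ModuleCat.of A (A ⧸ P)))
  rw [hPAP] at hloc
  exact isRegularLocalRing_of_pdLE hloc

instance isIntegrallyClosed_of_isRegularLocalRing [IsDomain A] : IsIntegrallyClosed A := by
  obtain ⟨d, hd⟩ := exists_ringKrullDim_eq A
  induction d using Nat.strong_induction_on generalizing A with
  | _ d ih =>
  obtain _ | n := d
  · let := (isField_of_ringKrullDim_eq_zero (A := A) (by simpa using hd)).toField
    infer_instance
  obtain ⟨x, hx, hx2⟩ := SetLike.not_le_iff_exists.mp
    (not_maximalIdeal_le_sq (maximalIdeal_ne_bot_of_ringKrullDim_eq_succ hd))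
  have hx0 : x ≠ 0 := fun h => hx2 (h ▸ zero_mem _)
  obtain ⟨_, -⟩ := isRegularLocalRing_quotient hd hx hx2
  have hprime : Prime x := (Ideal.span_singleton_prime hx0).mp
    ((Ideal.Quotient.isDomain_iff_prime _).mp isDomain_of_isRegularLocalRing)
  refine isIntegrallyClosed_of_forall_localization hprime fun P _ hxP => ?_
  have := isRegularLocalRing_localization P
  obtain ⟨k, hk⟩ := exists_ringKrullDim_eq (Localization.AtPrime P)
  have hlt := ringKrullDim_localization_lt (P := P) fun h => hxP (h ▸ hx)
  rw [hk, hd] at hlt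
  exact ih k (by exact_mod_cast hlt) hk

end Localization

/-! ### Affine models -/

section LocalSubrings

variable {K : Type*} [Field K]

theorem isUnit_iff_inv_mem {A : Subring K} {y : A} : IsUnit y ↔ (y : K) ≠ 0 ∧ (y : K)⁻¹ ∈ A := by
  constructor
  · intro h
    obtain ⟨z, hz⟩ := h.exists_right_inv
    have hyz : (y : K) * z = 1 := congrArg Subtype.val hz
    refine ⟨left_ne_zero_of_mul_eq_one hyz, ?_⟩
    rw [← eq_inv_of_mul_eq_one_right hyz]
    exact z.2
  · rintro ⟨h0, h⟩
    exact IsUnit.of_mul_eq_one ⟨_, h⟩ (Subtype.ext (mul_inv_cancel₀ h0))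

theorem mem_maximalIdeal_iff_inv_notMem {W : LocalSubring K} {y : W.toSubring} :
    y ∈ maximalIdeal W.toSubring ↔ ((y : K) ≠ 0 → (y : K)⁻¹ ∉ W.toSubring) := by
  rw [mem_maximalIdeal, mem_nonunits_iff, isUnit_iff_inv_mem, not_and]

theorem le_iff_inv_mem {S T : LocalSubring K} : S ≤ T ↔ S.toSubring ≤ T.toSubring ∧
    ∀ x ∈ S.toSubring, x ≠ 0 → x⁻¹ ∈ T.toSubring → x⁻¹ ∈ S.toSubring := by
  rw [LocalSubring.le_def]
  constructor
  · rintro ⟨h, hl⟩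
    refine ⟨h, fun x hx h0 hT => ?_⟩
    have hunit : IsUnit (Subring.inclusion h ⟨x, hx⟩) := isUnit_iff_inv_mem.mpr ⟨h0, hT⟩
    exact (isUnit_iff_inv_mem.mp (hl.map_nonunit _ hunit)).2
  · rintro ⟨h, hl⟩
    refine ⟨h, ⟨fun x hx => ?_⟩⟩
    obtain ⟨h0, h1⟩ := isUnit_iff_inv_mem.mp hx
    exact isUnit_iff_inv_mem.mpr ⟨h0, hl x x.2 h0 h1⟩

section AffineModel

variable {A : Subring K} {P : Ideal A}

theorem coe_ne_zero_of_notMem {s : A} (hs : s ∉ P) : (s : K) ≠ 0 := by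
  rintro h
  exact hs ((Subtype.ext h : s = 0) ▸ P.zero_mem)

theorem mem_ofPrime_iff [P.IsPrime] {x : K} :
    x ∈ (LocalSubring.ofPrime A P).toSubring ↔ ∃ a s : A, s ∉ P ∧ x = a / s := by
  have coe_mk' (a : A) (s : P.primeCompl) :
      ((IsLocalization.mk' (LocalSubring.ofPrime A P).toSubring a s :
        (LocalSubring.ofPrime A P).toSubring) : K) = a / (s : A) :=
    (eq_div_iff (coe_ne_zero_of_notMem s.2)).mpr
      (congrArg Subtype.val (IsLocalization.mk'_spec (LocalSubring.ofPrime A P).toSubring a s))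
  constructor
  · intro hx
    obtain ⟨a, s, h⟩ := IsLocalization.exists_mk'_eq P.primeCompl
      (⟨x, hx⟩ : (LocalSubring.ofPrime A P).toSubring)
    exact ⟨a, s, s.2, by rw [← coe_mk', h]⟩
  · rintro ⟨a, s, hs, rfl⟩
    exact coe_mk' a ⟨s, hs⟩ ▸ Subtype.property _

theorem inv_mem_ofPrime_iff [P.IsPrime] {s : A} (h0 : (s : K) ≠ 0) :
    (s : K)⁻¹ ∈ (LocalSubring.ofPrime A P).toSubring ↔ s ∉ P := by
  constructor
  · intro h hs
    obtain ⟨a, t, ht, hat⟩ := mem_ofPrime_iff.mp h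
    have htas : t = a * s := by
      have := coe_ne_zero_of_notMem ht
      field_simp at hat
      exact Subtype.ext (hat.trans (mul_comm _ _))
    exact ht (htas ▸ P.mul_mem_left _ hs)
  · intro hs
    exact mem_ofPrime_iff.mpr ⟨1, s, hs, by simp⟩

theorem ofPrime_comap_maximalIdeal_le {V : LocalSubring K} (h : A ≤ V.toSubring) :
    LocalSubring.ofPrime A ((maximalIdeal V.toSubring).comap (Subring.inclusion h)) ≤ V := by
  have inv_mem (s : A) (hs : s ∉ (maximalIdeal V.toSubring).comap (Subring.inclusion h)) :
      (s : K)⁻¹ ∈ V.toSubring :=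
    (isUnit_iff_inv_mem.mp (notMem_maximalIdeal.mp (Ideal.mem_comap.not.mp hs))).2
  rw [le_iff_inv_mem]
  constructor
  · intro x hx
    obtain ⟨a, s, hs, rfl⟩ := mem_ofPrime_iff.mp hx
    rw [div_eq_mul_inv]
    exact mul_mem (h a.2) (inv_mem s hs)
  · intro x hx h0 hinv
    obtain ⟨a, s, hs, rfl⟩ := mem_ofPrime_iff.mp hx
    obtain ⟨ha0, hs0⟩ := div_ne_zero_iff.mp h0
    rw [inv_div]
    refine mem_ofPrime_iff.mpr ⟨s, a, fun ha => ?_, rfl⟩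
    refine mem_maximalIdeal_iff_inv_notMem.mp (Ideal.mem_comap.mp ha) ha0 ?_
    have h3 : (a : K)⁻¹ = ((a : K) / s)⁻¹ * (s : K)⁻¹ := by field_simp
    exact h3 ▸ mul_mem hinv (inv_mem s hs)

theorem mem_affineModel_iff {W : LocalSubring K} : W ∈ affineModel A ↔
    A ≤ W.toSubring ∧ ∀ x ∈ W.toSubring, ∃ a ∈ A, ∃ s ∈ A,
      s ≠ 0 ∧ s⁻¹ ∈ W.toSubring ∧ x = a / s := by
  constructor
  · rintro ⟨P, hP, rfl⟩
    refine ⟨LocalSubring.le_ofPrime A P, fun x hx => ?_⟩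
    obtain ⟨a, s, hs, rfl⟩ := mem_ofPrime_iff.mp hx
    have hs0 := coe_ne_zero_of_notMem hs
    exact ⟨a, a.2, s, s.2, hs0, (inv_mem_ofPrime_iff hs0).mpr hs, rfl⟩
  · rintro ⟨h, hx⟩
    have hle := ofPrime_comap_maximalIdeal_le h
    refine ⟨_, inferInstance, le_antisymm (le_iff_inv_mem.mpr ⟨fun x hxW => ?_, ?_⟩) hle⟩
    · obtain ⟨a, ha, s, hs, hs0, hsi, rfl⟩ := hx x hxW
      exact mem_ofPrime_iff.mpr ⟨⟨a, ha⟩, ⟨s, hs⟩, fun hm =>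
        mem_maximalIdeal_iff_inv_notMem.mp (Ideal.mem_comap.mp hm) hs0 hsi, rfl⟩
    · exact fun x _ _ hinv => hle.1 hinv

theorem exists_mem_affineModel_le {V : LocalSubring K} (h : A ≤ V.toSubring) :
    ∃ T ∈ affineModel A, T ≤ V :=
  ⟨_, ⟨_, inferInstance, rfl⟩, ofPrime_comap_maximalIdeal_le h⟩

theorem mem_affineModel_of_le {B : Subring K} {W : LocalSubring K} (h : W ∈ affineModel A)
    (hAB : A ≤ B) (hBW : B ≤ W.toSubring) : W ∈ affineModel B := by
  rw [mem_affineModel_iff] at h ⊢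
  refine ⟨hBW, fun x hx => ?_⟩
  obtain ⟨a, ha, s, hs, h'⟩ := h.2 x hx
  exact ⟨a, hAB ha, s, hAB hs, h'⟩

theorem mem_affineModel_trans {T W : LocalSubring K} (hT : T ∈ affineModel A)
    (hW : W ∈ affineModel T.toSubring) : W ∈ affineModel A := by
  rw [mem_affineModel_iff] at hT hW ⊢
  refine ⟨hT.1.trans hW.1, fun x hx => ?_⟩
  obtain ⟨t, ht, u, hu, hu0, hui, rfl⟩ := hW.2 x hx
  obtain ⟨a, ha, s, hs, hs0, hsi, rfl⟩ := hT.2 t ht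
  obtain ⟨b, hb, r, hr, hr0, hri, rfl⟩ := hT.2 u hu
  obtain ⟨hb0, -⟩ := div_ne_zero_iff.mp hu0
  refine ⟨a * r, mul_mem ha hr, s * b, mul_mem hs hb, mul_ne_zero hs0 hb0, ?_, by field_simp⟩
  have hsb : (s * b)⁻¹ = s⁻¹ * ((b / r)⁻¹ * r⁻¹) := by field_simp
  rw [hsb]
  exact mul_mem (hW.1 hsi) (mul_mem hui (hW.1 hri))

theorem le_of_mem_affineModel {W : LocalSubring K} (h : W ∈ affineModel A) :
    A ≤ W.toSubring :=
  (mem_affineModel_iff.mp h).1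

theorem isNoetherianRing_of_mem_affineModel {W : LocalSubring K}
    (hW : W ∈ affineModel A) [IsNoetherianRing A] : IsNoetherianRing W.toSubring := by
  obtain ⟨P, hP, rfl⟩ := hW
  exact IsLocalization.isNoetherianRing P.primeCompl _ inferInstance

end AffineModel

theorem isFractionRing_iff {A : Subring K} :
    IsFractionRing A K ↔ ∀ x : K, ∃ a ∈ A, ∃ b ∈ A, b ≠ 0 ∧ x = a / b := by
  constructor
  · intro h x
    obtain ⟨a, b, hb, rfl⟩ := IsFractionRing.div_surjective (A := A) x
    exact ⟨a, a.2, b, b.2, fun h0 => nonZeroDivisors.ne_zero hb (Subtype.ext h0), rfl⟩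
  · intro h
    refine IsFractionRing.of_field A K fun x => ?_
    obtain ⟨a, ha, b, hb, -, rfl⟩ := h x
    exact ⟨⟨a, ha⟩, ⟨b, hb⟩, rfl⟩

theorem isFractionRing_of_le {A B : Subring K} (h : A ≤ B) [hA : IsFractionRing A K] :
    IsFractionRing B K := by
  rw [isFractionRing_iff] at hA ⊢
  intro x
  obtain ⟨a, ha, b, hb, h'⟩ := hA x
  exact ⟨a, h ha, b, h hb, h'⟩

end LocalSubrings

section Normal

variable {A : Type*} [CommRing A] [IsDomain A]

theorem exists_dvd_notMem_of_forall_dvd_iff [IsNoetherianRing A] [IsIntegrallyClosed A]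
    {P : Ideal A} (hP : P ≠ ⊤) {b c : A} (hb : b ≠ 0) (hPc : ∀ r, r ∈ P ↔ b ∣ r * c) :
    ∃ p ∈ P, ∃ u ∉ P, p * c = b * u := by
  by_contra! h
  let φ := algebraMap A (FractionRing A)
  have hφ : Function.Injective φ := FaithfulSMul.algebraMap_injective A (FractionRing A)
  have hφb : φ b ≠ 0 := (map_ne_zero_iff φ hφ).mpr hb
  have hbP : b ∈ P := (hPc b).mpr (dvd_mul_right b c)
  -- Multiplication by `c / b` maps the finitely generated module `P` into itself.
  have hint : IsIntegral A (φ c / φ b) := by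
    refine isIntegral_of_smul_mem_submodule
      (N := Submodule.map (Algebra.linearMap A (FractionRing A)) P)
      ((Submodule.ne_bot_iff _).mpr ⟨φ b, ⟨b, hbP, rfl⟩, hφb⟩)
      ((IsNoetherian.noetherian P).map _) _ ?_
    rintro _ ⟨q, hq, rfl⟩
    obtain ⟨w, hw⟩ := (hPc q).mp hq
    refine ⟨w, by_contra fun hwP => h q hq w hwP hw, ?_⟩
    rw [Algebra.linearMap_apply, Algebra.linearMap_apply, smul_eq_mul, div_mul_eq_mul_div,
      eq_div_iff hφb, ← map_mul, ← map_mul, mul_comm c, hw, mul_comm]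
  obtain ⟨d, hd⟩ := IsIntegrallyClosed.isIntegral_iff.mp hint
  rw [eq_div_iff hφb, ← map_mul] at hd
  refine hP ((Ideal.eq_top_iff_one _).mpr ((hPc 1).mpr ⟨d, ?_⟩))
  rw [one_mul, ← hφ hd, mul_comm]

theorem height_eq_one_of_forall_dvd_iff [IsNoetherianRing A] [IsIntegrallyClosed A]
    {P : Ideal A} [hP : P.IsPrime] {b c : A} (hb : b ≠ 0) (hPc : ∀ r, r ∈ P ↔ b ∣ r * c) :
    P.height = 1 := by
  have hbP : b ∈ P := (hPc b).mpr (dvd_mul_right b c)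
  obtain ⟨p, hp, u, hu, hpu⟩ := exists_dvd_notMem_of_forall_dvd_iff hP.ne_top hb hPc
  have hmin : P ∈ (Ideal.span {p}).minimalPrimes := by
    refine ⟨⟨hP, (Ideal.span_singleton_le_iff_mem _).mpr hp⟩, ?_⟩
    rintro Q ⟨hQ, hpQ⟩ hQP q hq
    obtain ⟨w, hw⟩ := (hPc q).mp hq
    have huq : u * q = p * w := mul_left_cancel₀ hb <|
      calc b * (u * q) = (p * c) * q := by rw [hpu]; ring
        _ = p * (q * c) := by ring
        _ = b * (p * w) := by rw [hw]; ring
    have huqQ : u * q ∈ Q := huq ▸ Q.mul_mem_right _ (hpQ (Ideal.mem_span_singleton_self p))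
    exact (hQ.mem_or_mem huqQ).resolve_left fun h => hu (hQP h)
  refine le_antisymm (Ideal.height_le_one_of_isPrincipal_of_mem_minimalPrimes _ P hmin) ?_
  rw [Order.one_le_iff_ne_zero, Ne, Ideal.height_eq_zero_iff,
    IsDomain.minimalPrimes_eq_singleton_bot, Set.mem_singleton_iff]
  rintro rfl
  exact hb (by simpa using hbP)

theorem exists_height_eq_one_of_not_dvd [IsNoetherianRing A] [IsIntegrallyClosed A] {a b : A}
    (hb : b ≠ 0) (hab : ¬ b ∣ a) :
    ∃ P : Ideal A, P.IsPrime ∧ P.height = 1 ∧ ∀ s ∉ P, ¬ b ∣ s * a := by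
  have hne : Ideal.Quotient.mk (Ideal.span {b}) a ≠ 0 := by
    rwa [Ne, Ideal.Quotient.eq_zero_iff_mem, Ideal.mem_span_singleton]
  obtain ⟨P, hP, hle⟩ := exists_le_isAssociatedPrime_of_isNoetherianRing A _ hne
  obtain ⟨hPp, c', rfl⟩ := isAssociatedPrime_iff.mp hP
  obtain ⟨c, rfl⟩ := Ideal.Quotient.mk_surjective c'
  have mem_colon_iff (r d : A) : r ∈ (⊥ : Submodule A (A ⧸ Ideal.span {b})).colon
      {Ideal.Quotient.mk (Ideal.span {b}) d} ↔ b ∣ r * d := by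
    rw [Submodule.mem_colon_singleton, Submodule.mem_bot, ← Ideal.mem_span_singleton,
      ← Ideal.Quotient.eq_zero_iff_mem]
    rfl
  exact ⟨_, hPp, height_eq_one_of_forall_dvd_iff hb fun r => mem_colon_iff r c,
    fun s hs hd => hs (hle ((mem_colon_iff s a).mpr hd))⟩

theorem isDiscreteValuationRing_of_ringKrullDim_eq_one [IsLocalRing A] [IsNoetherianRing A]
    [IsIntegrallyClosed A] (hd : ringKrullDim A = 1) : IsDiscreteValuationRing A := by
  have hf : ¬ IsField A := fun h => by
    rw [ringKrullDim_eq_zero_of_isField h] at hd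
    exact zero_ne_one hd
  have hmax : (maximalIdeal A).height = 1 := by
    exact_mod_cast maximalIdeal_height_eq_ringKrullDim.trans hd
  refine ((IsDiscreteValuationRing.TFAE A hf).out 0 3 :
    IsDiscreteValuationRing A ↔ IsIntegrallyClosed A ∧ ∃! Q : Ideal A, Q ≠ ⊥ ∧ Q.IsPrime).mpr
    ⟨inferInstance, maximalIdeal A, ⟨isField_iff_maximalIdeal_eq.not.mp hf, inferInstance⟩,
      fun Q ⟨hQ0, hQ⟩ => ?_⟩
  by_contra hne
  have hlt := Ideal.height_strict_mono_of_isPrime ((le_maximalIdeal hQ.ne_top).lt_of_ne hne)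
  rw [hmax, Order.lt_one_iff, Ideal.height_eq_zero_iff,
    IsDomain.minimalPrimes_eq_singleton_bot] at hlt
  exact hQ0 hlt

theorem isDiscreteValuationRing_of_height_eq_one [IsNoetherianRing A] [IsIntegrallyClosed A]
    (P : Ideal A) [P.IsPrime] (hP : P.height = 1) (B : Type*) [CommRing B] [IsDomain B]
    [Algebra A B] [IsLocalization.AtPrime B P] : IsDiscreteValuationRing B := by
  have := IsLocalization.AtPrime.isLocalRing B P
  have : IsNoetherianRing B := IsLocalization.isNoetherianRing P.primeCompl B inferInstance
  have := isIntegrallyClosed_of_isLocalization B P.primeCompl P.primeCompl_le_nonZeroDivisors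
  refine isDiscreteValuationRing_of_ringKrullDim_eq_one ?_
  rw [IsLocalization.AtPrime.ringKrullDim_eq_height P B, hP]
  rfl

theorem mem_of_forall_isDiscreteValuationRing {K : Type*} [Field K] {A : Subring K}
    [IsNoetherianRing A] [IsIntegrallyClosed A] [hA : IsFractionRing A K] {x : K}
    (h : ∀ W ∈ affineModel A, IsDiscreteValuationRing W.toSubring → x ∈ W.toSubring) :
    x ∈ A := by
  obtain ⟨a, ha, b, hb, hb0, rfl⟩ := isFractionRing_iff.mp hA x
  by_contra hx
  have hdvd : ¬ (⟨b, hb⟩ : A) ∣ ⟨a, ha⟩ := by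
    rintro ⟨c, hc⟩
    have habc : a = b * c := congrArg Subtype.val hc
    exact hx (by rw [habc, mul_div_cancel_left₀ _ hb0]; exact c.2)
  obtain ⟨P, hP, hP1, hs⟩ := exists_height_eq_one_of_not_dvd
    (fun h0 => hb0 (congrArg Subtype.val h0)) hdvd
  obtain ⟨c, s, hsP, hcs⟩ := mem_ofPrime_iff.mp (h (LocalSubring.ofPrime A P) ⟨P, hP, rfl⟩
    (isDiscreteValuationRing_of_height_eq_one P hP1 _))
  rw [div_eq_div_iff hb0 (coe_ne_zero_of_notMem hsP)] at hcs
  exact hs s hsP ⟨c, Subtype.ext (by push_cast; rw [mul_comm, hcs, mul_comm])⟩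

end Normal

/-! ### Fractions of a regular sequence -/

section RegularSequence

section PolynomialRing

open Polynomial

variable {D B : Type*} [CommRing D] [CommRing B] [Algebra D B] [FaithfulSMul D B]

theorem dvd_leadingCoeff_of_aeval_eq_zero {a y : D} (hreg : ∀ d, a ∣ y * d → a ∣ d) {t : B}
    (ht : algebraMap D B a * t = algebraMap D B y) {F : D[X]} (hF : aeval t F = 0) :
    a ∣ F.leadingCoeff := by
  have hscale : (F.scaleRoots a).eval y = 0 := by
    have h := scaleRoots_aeval_eq_zero (r := a) hF
    rwa [ht, aeval_algebraMap_apply_eq_algebraMap_eval, FaithfulSMul.algebraMap_eq_zero_iff] at h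
  have hdvd : a ∣ y ^ F.natDegree * F.leadingCoeff := by
    rw [mul_comm, ← F.coeff_scaleRoots_natDegree a]
    refine dvd_term_of_dvd_eval_of_dvd_terms _ (hscale ▸ dvd_zero a) fun j hj => ?_
    rw [coeff_scaleRoots]
    obtain hlt | hlt := hj.lt_or_gt
    · exact ((dvd_pow_self a (by omega)).mul_left _).mul_right _
    · simp [coeff_eq_zero_of_natDegree_lt hlt]
  have dvd_of_dvd_pow_mul (k : ℕ) (d : D) (hd : a ∣ y ^ k * d) : a ∣ d := by
    induction k with
    | zero => simpa using hd
    | succ k ih => exact ih (hreg _ (by rwa [pow_succ', mul_assoc] at hd))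
  exact dvd_of_dvd_pow_mul _ _ hdvd

theorem mem_map_C_span_pair_of_aeval_eq_zero {a y : D} (hreg : ∀ d, a ∣ y * d → a ∣ d) {t : B}
    (ht : algebraMap D B a * t = algebraMap D B y) {F : D[X]} (hF : aeval t F = 0) :
    F ∈ (Ideal.span {a, y}).map (C : D →+* D[X]) := by
  induction hn : F.natDegree using Nat.strong_induction_on generalizing F with
  | _ n ih =>
  obtain _ | n := n
  · rw [eq_C_of_natDegree_eq_zero hn, aeval_C, FaithfulSMul.algebraMap_eq_zero_iff] at hF
    rw [eq_C_of_natDegree_eq_zero hn, hF, C_0]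
    exact zero_mem _
  obtain ⟨c, hc⟩ := dvd_leadingCoeff_of_aeval_eq_zero hreg ht hF
  rw [leadingCoeff, hn] at hc
  -- `a X - y` vanishes at `t`, so a multiple of it can be used to lower the degree.
  let G := C c * X ^ n * (C a * X - C y)
  have hG : G = C (a * c) * X ^ (n + 1) - C (c * y) * X ^ n := by
    simp only [G, C_mul]
    ring
  have hdeg : (F - G).natDegree ≤ n := by
    refine natDegree_le_iff_coeff_eq_zero.mpr fun N hN => ?_
    rw [hG, coeff_sub, coeff_sub, coeff_C_mul_X_pow, coeff_C_mul_X_pow, if_neg hN.ne']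
    split_ifs with h
    · rw [h, hc, sub_zero, sub_self]
    · rw [coeff_eq_zero_of_natDegree_lt (by omega), sub_zero, sub_zero]
  have hFG : F - G ∈ (Ideal.span {a, y}).map C :=
    ih _ (Nat.lt_succ_of_le hdeg) (by simp [G, hF, ht]) rfl
  have hCa : C a ∈ (Ideal.span {a, y}).map C :=
    Ideal.mem_map_of_mem C (Ideal.subset_span (by simp))
  have hCy : C y ∈ (Ideal.span {a, y}).map C :=
    Ideal.mem_map_of_mem C (Ideal.subset_span (by simp))
  rw [← sub_add_cancel F G]
  exact add_mem hFG (Ideal.mul_mem_left _ _ (sub_mem (Ideal.mul_mem_right _ _ hCa) hCy))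

end PolynomialRing

section EvalFractions

open MvPolynomial

variable {S K : Type*} [CommRing S] [Field K] [Algebra S K] {a : S} {n : ℕ}

variable (K) in
/-- The evaluation of polynomials at the fractions `yᵢ / a`, whose image is `S[y₁/a, …, yₙ/a]`. -/
noncomputable def evalFractions (a : S) (y : Fin n → S) : MvPolynomial (Fin n) S →ₐ[S] K :=
  aeval fun i => algebraMap S K (y i) / algebraMap S K a

theorem evalFractions_eq_eval₂_finSuccEquiv (y : Fin (n + 1) → S)
    (F : MvPolynomial (Fin (n + 1)) S) :
    evalFractions K a y F = Polynomial.eval₂ (evalFractions K a (Fin.tail y)).toRingHom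
      (algebraMap S K (y 0) / algebraMap S K a) (finSuccEquiv S n F) := by
  induction F using MvPolynomial.induction_on with
  | C c => simp [evalFractions, finSuccEquiv_apply]
  | add p q hp hq => rw [map_add, map_add, Polynomial.eval₂_add, hp, hq]
  | mul_X p i hp =>
    rw [map_mul, map_mul, Polynomial.eval₂_mul, hp]
    congr 1
    refine Fin.cases ?_ (fun j => ?_) i
    · simp [evalFractions, finSuccEquiv_X_zero]
    · simp [evalFractions, finSuccEquiv_X_succ, Fin.tail]

theorem mem_map_C_of_dvd_rangeRestrict {J : Ideal S} {y : Fin n → S} (haJ : a ∈ J)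
    (hJ : ∀ F, evalFractions K a y F = 0 → F ∈ J.map (C : S →+* MvPolynomial (Fin n) S))
    {F : MvPolynomial (Fin n) S}
    (hF : algebraMap S (evalFractions K a y).range a ∣ (evalFractions K a y).rangeRestrict F) :
    F ∈ J.map (C : S →+* MvPolynomial (Fin n) S) := by
  obtain ⟨d, hd⟩ := hF
  obtain ⟨G, rfl⟩ := (evalFractions K a y).rangeRestrict_surjective d
  have hFG : evalFractions K a y F = algebraMap S K a * evalFractions K a y G :=
    congrArg Subtype.val hd
  have hsub : F - C a * G ∈ J.map C := hJ _ <| by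
    rw [map_sub, map_mul, hFG, sub_eq_zero, evalFractions, aeval_C]
  rw [← sub_add_cancel F (C a * G)]
  exact add_mem hsub (Ideal.mul_mem_right _ _ (Ideal.mem_map_of_mem C haJ))

variable [FaithfulSMul S K]

theorem dvd_rangeRestrict_of_mem_map_C (ha : a ≠ 0) {y : Fin n → S} {F : MvPolynomial (Fin n) S}
    (hF : F ∈ (Ideal.span (insert a (Set.range y))).map (C : S →+* MvPolynomial (Fin n) S)) :
    algebraMap S (evalFractions K a y).range a ∣ (evalFractions K a y).rangeRestrict F := by
  have haK : algebraMap S K a ≠ 0 := by rwa [Ne, FaithfulSMul.algebraMap_eq_zero_iff]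
  rw [← Ideal.mem_span_singleton, ← Ideal.mem_comap]
  refine (Ideal.map_le_iff_le_comap.mpr (Ideal.span_le.mpr ?_) :
    _ ≤ Ideal.comap (evalFractions K a y).rangeRestrict _) hF
  have rangeRestrict_C (s : S) : (evalFractions K a y).rangeRestrict (C s) =
      algebraMap S (evalFractions K a y).range s :=
    (evalFractions K a y).rangeRestrict.commutes s
  rintro _ (rfl | ⟨i, rfl⟩)
  · exact Ideal.mem_span_singleton.mpr (rangeRestrict_C _).symm.dvd
  · refine Ideal.mem_span_singleton.mpr
      ⟨(evalFractions K a y).rangeRestrict (X i), (rangeRestrict_C _).trans (Subtype.ext ?_)⟩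
    change algebraMap S K (y i) = algebraMap S K a * evalFractions K a y (X i)
    rw [evalFractions, aeval_X, mul_div_cancel₀ _ haK]

theorem mem_map_C_of_evalFractions_succ_eq_zero (ha : a ≠ 0) {y : Fin (n + 1) → S}
    (htail : ∀ G, evalFractions K a (Fin.tail y) G = 0 →
      G ∈ (Ideal.span (insert a (Set.range (Fin.tail y)))).map (C : S →+* MvPolynomial (Fin n) S))
    (hy : ∀ x, y 0 * x ∈ Ideal.span (insert a (Set.range (Fin.tail y))) →
      x ∈ Ideal.span (insert a (Set.range (Fin.tail y))))
    {F : MvPolynomial (Fin (n + 1)) S} (hF : evalFractions K a y F = 0) :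
    F ∈ (Ideal.span (insert a (Set.range y))).map (C : S →+* MvPolynomial (Fin (n + 1)) S) := by
  let φ := evalFractions K a (Fin.tail y)
  let J := Ideal.span (insert a (Set.range (Fin.tail y)))
  have mem_J {G} (h : algebraMap S φ.range a ∣ φ.rangeRestrict G) : G ∈ J.map C :=
    mem_map_C_of_dvd_rangeRestrict (Ideal.subset_span (Set.mem_insert _ _)) htail h
  have rangeRestrict_C (s : S) : φ.rangeRestrict (C s) = algebraMap S φ.range s :=
    φ.rangeRestrict.commutes s
  have hreg (d : φ.range) (hd : algebraMap S φ.range a ∣ algebraMap S φ.range (y 0) * d) :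
      algebraMap S φ.range a ∣ d := by
    obtain ⟨G, rfl⟩ := φ.rangeRestrict_surjective d
    rw [← rangeRestrict_C (y 0), ← map_mul] at hd
    refine dvd_rangeRestrict_of_mem_map_C ha (mem_map_C_iff.mpr fun m => hy _ ?_)
    simpa only [coeff_C_mul] using mem_map_C_iff.mp (mem_J hd) m
  have haK : algebraMap S K a ≠ 0 := by rwa [Ne, FaithfulSMul.algebraMap_eq_zero_iff]
  let H := finSuccEquiv S n F
  have hH : Polynomial.aeval (algebraMap S K (y 0) / algebraMap S K a)
      (H.map φ.rangeRestrict.toRingHom) = 0 := by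
    rw [Polynomial.aeval_def, Polynomial.eval₂_map, ← hF, evalFractions_eq_eval₂_finSuccEquiv]
    rfl
  have hHmem := mem_map_C_span_pair_of_aeval_eq_zero hreg
    (mul_div_cancel₀ (algebraMap S K (y 0)) haK) hH
  refine mem_map_C_iff.mpr fun m => ?_
  rw [← Finsupp.cons_tail m, ← finSuccEquiv_coeff_coeff]
  obtain ⟨u, v, huv⟩ := Ideal.mem_span_pair.mp (Ideal.mem_map_C_iff.mp hHmem (m 0))
  obtain ⟨V, rfl⟩ := φ.rangeRestrict_surjective v
  rw [Polynomial.coeff_map] at huv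
  have hHV : H.coeff (m 0) - V * C (y 0) ∈ J.map C := mem_J ⟨u, by
    rw [map_sub, map_mul, rangeRestrict_C, mul_comm _ u]
    exact sub_eq_iff_eq_add.mpr huv.symm⟩
  have hJ : J ≤ Ideal.span (insert a (Set.range y)) :=
    Ideal.span_mono (Set.insert_subset_insert (Set.range_comp_subset_range Fin.succ y))
  have hm := mem_map_C_iff.mp hHV m.tail
  rw [coeff_sub, mul_comm, coeff_C_mul] at hm
  rw [← sub_add_cancel (coeff _ _)]
  exact add_mem (hJ hm)
    (Ideal.mul_mem_right _ _ (Ideal.subset_span (Set.mem_insert_of_mem a ⟨0, rfl⟩)))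

/-- Modulo `a`, the fractions `yᵢ / a` are algebraically independent over `S / (a, y₁, …, yₙ)`. -/
theorem mem_map_C_of_evalFractions_eq_zero (ha : a ≠ 0) {y : Fin n → S}
    (hy : ∀ i x, y i * x ∈ Ideal.span (insert a (y '' Set.Ioi i)) →
      x ∈ Ideal.span (insert a (y '' Set.Ioi i)))
    {F : MvPolynomial (Fin n) S} (hF : evalFractions K a y F = 0) :
    F ∈ (Ideal.span (insert a (Set.range y))).map (C : S →+* MvPolynomial (Fin n) S) := by
  induction n with
  | zero =>
    obtain ⟨f, rfl⟩ := C_surjective (Fin 0) F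
    rw [evalFractions, aeval_C, FaithfulSMul.algebraMap_eq_zero_iff] at hF
    rw [hF, C_0]
    exact zero_mem _
  | succ n ih =>
    have image_tail (i : Fin n) : Fin.tail y '' Set.Ioi i = y '' Set.Ioi i.succ := by
      rw [← Fin.image_succ_Ioi, Set.image_image]
      rfl
    have range_tail : Set.range (Fin.tail y) = y '' Set.Ioi 0 := by
      ext
      simp [Fin.exists_fin_succ, Fin.tail]
    refine mem_map_C_of_evalFractions_succ_eq_zero ha (fun G => ih fun i x => ?_) ?_ hF
    · rw [image_tail]
      exact hy i.succ x
    · rw [range_tail]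
      exact hy 0

end EvalFractions

section RegularLocalRing

variable {S ι : Type*} [CommRing S] [IsRegularLocalRing S] [Finite ι] {z : ι → S}

theorem isPrime_span_image (hd : ringKrullDim S = Nat.card ι)
    (hz : Ideal.span (Set.range z) = maximalIdeal S) (s : Set ι) :
    (Ideal.span (z '' s)).IsPrime := by
  have hle : Ideal.span (z '' s) ≤ maximalIdeal S :=
    hz ▸ Ideal.span_mono (Set.image_subset_range _ _)
  have := isLocalRing_quotient hle
  have hmax : Ideal.span (Ideal.Quotient.mk (Ideal.span (z '' s)) '' (z '' sᶜ)) =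
      maximalIdeal (S ⧸ Ideal.span (z '' s)) := by
    rw [← IsLocalRing.map_maximalIdeal_of_surjective _ Ideal.Quotient.mk_surjective, ← hz,
      ← Set.image_univ, ← Set.union_compl_self s, Set.image_union, Ideal.span_union,
      Ideal.map_sup, Ideal.map_quotient_self, bot_sup_eq, Ideal.map_span]
  have hdim : ((sᶜ.ncard : ℕ) : WithBot ℕ∞) ≤ ringKrullDim (S ⧸ Ideal.span (z '' s)) := by
    have h := ringKrullDim_le_ringKrullDim_quotient_add_card
      (s := (s.toFinite.image z).toFinset) (R := S) (by
        rw [IsLocalRing.ringJacobson_eq_maximalIdeal]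
        exact fun x hx => hle (Ideal.subset_span (by simpa using hx)))
    obtain ⟨e, he⟩ := exists_ringKrullDim_eq (S ⧸ Ideal.span (z '' s))
    rw [Set.Finite.coe_toFinset, he, hd,
      ← Set.ncard_eq_toFinset_card _ (s.toFinite.image z)] at h
    have hcard := Set.ncard_add_ncard_compl s
    have himage := Set.ncard_image_le (f := z) s.toFinite
    have hle' : Nat.card ι ≤ e + (z '' s).ncard := by exact_mod_cast h
    rw [he]
    exact_mod_cast (by omega : sᶜ.ncard ≤ e)
  have hrank : ((maximalIdeal (S ⧸ Ideal.span (z '' s))).spanFinrank : WithBot ℕ∞) ≤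
      (sᶜ.ncard : ℕ) := by
    rw [← hmax]
    exact_mod_cast (Submodule.spanFinrank_span_le_ncard_of_finite (Set.toFinite _)).trans
      ((Set.ncard_image_le (Set.toFinite _)).trans (Set.ncard_image_le sᶜ.toFinite))
  have := IsRegularLocalRing.of_spanFinrank_maximalIdeal_le _ (hrank.trans hdim)
  exact (Ideal.Quotient.isDomain_iff_prime _).mp isDomain_of_isRegularLocalRing

theorem notMem_span_image (hd : ringKrullDim S = Nat.card ι)
    (hz : Ideal.span (Set.range z) = maximalIdeal S) {s : Set ι} {i : ι} (hi : i ∉ s) :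
    z i ∉ Ideal.span (z '' s) := by
  intro h
  have hmax : Ideal.span (z '' {i}ᶜ) = maximalIdeal S := by
    refine le_antisymm (hz ▸ Ideal.span_mono (Set.image_subset_range _ _)) ?_
    rw [← hz, Ideal.span_le]
    rintro _ ⟨j, rfl⟩
    obtain rfl | hj := eq_or_ne j i
    · exact Ideal.span_mono (Set.image_mono (Set.subset_compl_singleton_iff.mpr hi)) h
    · exact Ideal.subset_span ⟨j, hj, rfl⟩
  have hdim := ringKrullDim_le_spanFinrank_maximalIdeal S
  have hrank := (Submodule.spanFinrank_span_le_ncard_of_finite (R := S)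
    (Set.toFinite (z '' {i}ᶜ))).trans (Set.ncard_image_le (Set.toFinite _))
  rw [hd, ← hmax] at hdim
  have hcard := Set.ncard_add_ncard_compl {i}
  rw [Set.ncard_singleton] at hcard
  have hle : Nat.card ι ≤ (Submodule.spanFinrank (Ideal.span (z '' {i}ᶜ))) := by
    exact_mod_cast hdim
  exact absurd (hle.trans hrank) (by omega)

end RegularLocalRing

theorem mem_span_insert_image_Ioi_of_mul_mem {S : Type*} [CommRing S] [IsRegularLocalRing S]
    {n : ℕ} (hd : ringKrullDim S = (n + 1 : ℕ)) {a : S} {y : Fin n → S}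
    (hy : Ideal.span (insert a (Set.range y)) = maximalIdeal S) (i : Fin n) {x : S}
    (hx : y i * x ∈ Ideal.span (insert a (y '' Set.Ioi i))) :
    x ∈ Ideal.span (insert a (y '' Set.Ioi i)) := by
  let z : Fin (n + 1) → S := Fin.cons a y
  have hz : Ideal.span (Set.range z) = maximalIdeal S := by rwa [Fin.range_cons]
  have hd' : ringKrullDim S = Nat.card (Fin (n + 1)) := by rwa [Nat.card_fin]
  have himage : z '' insert 0 (Fin.succ '' Set.Ioi i) = insert a (y '' Set.Ioi i) := by
    rw [Set.image_insert_eq, Set.image_image]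
    rfl
  have hmem := notMem_span_image hd' hz (s := insert 0 (Fin.succ '' Set.Ioi i)) (i := i.succ)
    (by simp [Fin.succ_ne_zero])
  have hprime := isPrime_span_image hd' hz (insert 0 (Fin.succ '' Set.Ioi i))
  rw [himage] at hmem hprime
  exact (hprime.mem_or_mem hx).resolve_left hmem

end RegularSequence

/-! ### Blowing up the maximal ideal of a regular local ring -/

section Chart

variable {K : Type*} [Field K] {R : Subring K} {I : Ideal R} {a : R}

theorem le_blowupChart : R ≤ blowupChart R I a := fun x hx =>
  (Algebra.adjoin R {x : K | ∃ b ∈ I, x = (b : K) / (a : K)}).algebraMap_mem ⟨x, hx⟩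

theorem div_mem_blowupChart {b : R} (hb : b ∈ I) : (b : K) / a ∈ blowupChart R I a :=
  Algebra.subset_adjoin ⟨b, hb, rfl⟩

theorem blowupChart_le {B : Subring K} (hR : R ≤ B) (h : ∀ b ∈ I, (b : K) / a ∈ B) :
    blowupChart R I a ≤ B := by
  intro x hx
  induction hx using Algebra.adjoin_induction with
  | mem x hx => obtain ⟨b, hb, rfl⟩ := hx; exact h b hb
  | algebraMap r => exact hR r.2
  | add x y _ _ hx hy => exact add_mem hx hy
  | mul x y _ _ hx hy => exact mul_mem hx hy

theorem div_pow_mem_of_mem_pow {B : Subring K} (hR : R ≤ B) (h : ∀ b ∈ I, (b : K) / a ∈ B)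
    {n : ℕ} {x : R} (hx : x ∈ I ^ n) : (x : K) / a ^ n ∈ B := by
  induction hx using Submodule.pow_induction_on_left' with
  | algebraMap r => simpa using hR r.2
  | add x y i _ _ ihx ihy => rw [Subring.coe_add, add_div]; exact add_mem ihx ihy
  | mem_mul m hm i x _ ih =>
    rw [Subring.coe_mul, pow_succ', mul_div_mul_comm]
    exact mul_mem (h m hm) ih

theorem exists_eq_div_pow_of_mem_blowupChart (ha : a ∈ I) (ha0 : (a : K) ≠ 0) {x : K}
    (hx : x ∈ blowupChart R I a) : ∃ n : ℕ, ∃ f ∈ I ^ n, x = (f : K) / a ^ n := by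
  induction hx using Algebra.adjoin_induction with
  | mem x hx =>
    obtain ⟨b, hb, rfl⟩ := hx
    exact ⟨1, b, by simpa using hb, by simp⟩
  | algebraMap r => exact ⟨0, r, by simp, by simp; rfl⟩
  | add x y _ _ hx hy =>
    obtain ⟨n, f, hf, rfl⟩ := hx
    obtain ⟨k, g, hg, rfl⟩ := hy
    refine ⟨n + k, f * a ^ k + a ^ n * g, ?_, ?_⟩
    · rw [pow_add]
      exact Ideal.add_mem _ (Ideal.mul_mem_mul hf (Ideal.pow_mem_pow ha k))
        (Ideal.mul_mem_mul (Ideal.pow_mem_pow ha n) hg)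
    · push_cast
      rw [pow_add]
      field_simp
  | mul x y _ _ hx hy =>
    obtain ⟨n, f, hf, rfl⟩ := hx
    obtain ⟨k, g, hg, rfl⟩ := hy
    refine ⟨n + k, f * g, pow_add I n k ▸ Ideal.mul_mem_mul hf hg, ?_⟩
    push_cast
    rw [pow_add]
    field_simp

theorem blowupChart_eq_range (ha0 : (a : K) ≠ 0) {n : ℕ} {y : Fin n → R}
    (hI : Ideal.span (insert a (Set.range y)) = I) :
    blowupChart R I a = (evalFractions K a y).range.toSubring := by
  refine le_antisymm (blowupChart_le ?_ fun b hb => ?_) ?_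
  · exact fun r hr => (evalFractions K a y).range.algebraMap_mem ⟨r, hr⟩
  · obtain ⟨c, hc⟩ := dvd_rangeRestrict_of_mem_map_C (K := K) (ZeroMemClass.coe_eq_zero.not.mp ha0)
      (hI ▸ Ideal.mem_map_of_mem MvPolynomial.C hb)
    have hbc : (b : K) = a * c :=
      (MvPolynomial.aeval_C _ b).symm.trans (congrArg Subtype.val hc)
    rw [hbc, mul_div_cancel_left₀ _ ha0]
    exact c.2
  · rintro _ ⟨F, rfl⟩
    change evalFractions K a y F ∈ _
    induction F using MvPolynomial.induction_on with
    | C c => rw [evalFractions, MvPolynomial.aeval_C]; exact le_blowupChart c.2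
    | add p q hp hq => rw [map_add]; exact add_mem hp hq
    | mul_X p i hp =>
      rw [map_mul]
      refine mul_mem hp ?_
      rw [evalFractions, MvPolynomial.aeval_X]
      exact div_mem_blowupChart (hI ▸ Ideal.subset_span (Set.mem_insert_of_mem _ ⟨i, rfl⟩))

end Chart

section RegularChart

theorem isRegularRing_quotient_range_evalFractions {S K : Type*} [CommRing S]
    [IsRegularLocalRing S] [Field K] [Algebra S K] [FaithfulSMul S K] {n : ℕ}
    (hd : ringKrullDim S = (n + 1 : ℕ)) {a : S} (ha : a ≠ 0) {y : Fin n → S}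
    (hy : Ideal.span (insert a (Set.range y)) = maximalIdeal S) :
    IsRegularRing ((evalFractions K a y).range ⧸
      Ideal.span {algebraMap S (evalFractions K a y).range a}) := by
  let θ := (Ideal.Quotient.mk (Ideal.span {algebraMap S (evalFractions K a y).range a})).comp
    (evalFractions K a y).rangeRestrict.toRingHom
  have hθ : Function.Surjective θ :=
    Ideal.Quotient.mk_surjective.comp (evalFractions K a y).rangeRestrict_surjective
  have mem_ker_θ_iff (F) : F ∈ RingHom.ker θ ↔ algebraMap S (evalFractions K a y).range a ∣
      (evalFractions K a y).rangeRestrict F := by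
    rw [RingHom.mem_ker, RingHom.comp_apply, Ideal.Quotient.eq_zero_iff_mem,
      Ideal.mem_span_singleton]
    rfl
  have map_C_eq_ker : (maximalIdeal S).map MvPolynomial.C = RingHom.ker θ := by
    ext F
    rw [mem_ker_θ_iff]
    refine ⟨fun hF => dvd_rangeRestrict_of_mem_map_C ha (hy ▸ hF), fun hF => ?_⟩
    refine mem_map_C_of_dvd_rangeRestrict (hy ▸ Ideal.subset_span (Set.mem_insert _ _)) ?_ hF
    intro G hG
    rw [← hy]
    exact mem_map_C_of_evalFractions_eq_zero ha
      (fun i x hx => mem_span_insert_image_Ioi_of_mul_mem hd hy i hx) hG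
  let := Ideal.Quotient.field (maximalIdeal S)
  exact IsRegularRing.of_ringEquiv <|
    (MvPolynomial.quotientEquivQuotientMvPolynomial (maximalIdeal S)).toRingEquiv.trans <|
      (Ideal.quotEquivOfEq map_C_eq_ker).trans (RingHom.quotientKerEquivOfSurjective hθ)

theorem isRegularLocalRing_of_isRegularRing_quotient {A T : Type*} [CommRing A]
    [IsNoetherianRing A] {a : A} (ha : a ∈ nonZeroDivisors A) [IsRegularRing (A ⧸ Ideal.span {a})]
    {Q : Ideal A} [Q.IsPrime] (haQ : a ∈ Q) [CommRing T] [Algebra A T]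
    [IsLocalization.AtPrime T Q] : IsRegularLocalRing T := by
  have := IsLocalization.AtPrime.isLocalRing T Q
  have := IsLocalization.isNoetherianRing Q.primeCompl T inferInstance
  let J := Ideal.span {a}
  have hJQ : J ≤ Q := (Ideal.span_singleton_le_iff_mem Q).mpr haQ
  let q := Q.map (Ideal.Quotient.mk J)
  have hq : q.comap (Ideal.Quotient.mk J) = Q := by
    rw [Ideal.comap_map_of_surjective' _ Ideal.Quotient.mk_surjective, Ideal.mk_ker, sup_eq_left]
    exact hJQ
  have : q.IsPrime := Ideal.map_isPrime_of_surjective Ideal.Quotient.mk_surjective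
    (by rwa [Ideal.mk_ker])
  have hM : Algebra.algebraMapSubmonoid (A ⧸ J) Q.primeCompl = q.primeCompl := by
    rw [← q.map_primeCompl_comap_of_surjective (f := Ideal.Quotient.mk J)
      Ideal.Quotient.mk_surjective]
    simp only [hq]
    rfl
  have : IsLocalization.AtPrime (T ⧸ J.map (algebraMap A T)) q := by
    rw [IsLocalization.AtPrime, ← hM]
    infer_instance
  have : IsRegularLocalRing (T ⧸ Ideal.span {algebraMap A T a}) := by
    rw [← Set.image_singleton, ← Ideal.map_span]
    exact IsRegularLocalRing.of_ringEquiv (R := Localization.AtPrime q)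
      (IsLocalization.algEquiv q.primeCompl _ _).toRingEquiv
  exact isRegularLocalRing_of_quotient
    (IsLocalization.map_nonZeroDivisors_le Q.primeCompl T ⟨a, ha, rfl⟩)
    ((IsLocalization.AtPrime.to_map_mem_maximal_iff T Q a).mpr haQ)

variable {K : Type*} [Field K]

theorem isRegularLocalRing_of_mem_affineModel_blowupChart {S : Subring K} [IsRegularLocalRing S]
    {a : S} (ha : a ∈ maximalIdeal S) (ha2 : a ∉ maximalIdeal S ^ 2) {T : LocalSubring K}
    (hT : T ∈ affineModel (blowupChart S (maximalIdeal S) a)) (haT : (a : K)⁻¹ ∉ T.toSubring) :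
    IsRegularLocalRing T.toSubring := by
  have ha0 : a ≠ 0 := by rintro rfl; exact ha2 (zero_mem _)
  have ha0' : (a : K) ≠ 0 := ZeroMemClass.coe_eq_zero.not.mpr ha0
  obtain ⟨_ | n, hd⟩ := exists_ringKrullDim_eq S
  · rw [isField_iff_maximalIdeal_eq.mp (isField_of_ringKrullDim_eq_zero hd)] at ha
    exact absurd ha ha0
  obtain ⟨y, hy⟩ := exists_span_insert_eq_maximalIdeal hd ha ha2
  rw [blowupChart_eq_range ha0' hy] at hT
  let B := (evalFractions K a y).range.toSubring
  let aB : B := algebraMap S (evalFractions K a y).range a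
  have : IsNoetherianRing B :=
    isNoetherianRing_of_surjective _ _ _ (evalFractions K a y).rangeRestrict_surjective
  have : IsRegularRing (B ⧸ Ideal.span {aB}) :=
    isRegularRing_quotient_range_evalFractions hd ha0 hy
  obtain ⟨Q, hQ, rfl⟩ := hT
  have haQ : aB ∈ Q := by
    by_contra haQ
    exact haT ((inv_mem_ofPrime_iff (s := aB) ha0').mpr haQ)
  have haB : aB ∈ nonZeroDivisors B :=
    mem_nonZeroDivisors_of_ne_zero fun h => ha0' (congrArg Subtype.val h)
  exact isRegularLocalRing_of_isRegularRing_quotient haB haQ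

end RegularChart

section QuadraticTransform

variable {K : Type*} [Field K]

theorem eq_of_isDiscreteValuationRing_le {B C : Subring K} [IsDiscreteValuationRing B]
    [IsFractionRing B K] (h : B ≤ C) (hC : C ≠ ⊤) : C = B := by
  refine le_antisymm (fun c hc => ?_) h
  by_contra hcB
  obtain ⟨b, hb⟩ : c⁻¹ ∈ Set.range (algebraMap B K) :=
    (ValuationRing.isInteger_or_isInteger B c).resolve_left fun ⟨b, hb⟩ => hcB (hb ▸ b.2)
  have hbm : b ∈ maximalIdeal B := by
    rw [mem_maximalIdeal, mem_nonunits_iff, isUnit_iff_inv_mem]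
    rintro ⟨-, hinv⟩
    exact hcB (inv_inv c ▸ hb ▸ hinv)
  -- Every nonzero element of `B` divides a power of `b`, which is invertible in `C`.
  refine hC (eq_top_iff.mpr fun z _ => ?_)
  obtain ⟨x, y, hy, rfl⟩ := IsFractionRing.div_surjective (A := B) z
  have hy0 : y ≠ 0 := nonZeroDivisors.ne_zero hy
  have hby : b ∈ (Ideal.span {y}).radical := by
    rw [Ideal.radical_eq_sInf, Ideal.mem_sInf]
    rintro P ⟨hyP, hP⟩
    have hP0 : P ≠ ⊥ := by
      rintro rfl
      exact hy0 ((Ideal.span_singleton_le_iff_mem _).mp hyP)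
    have := hP.isMaximal hP0
    rwa [eq_maximalIdeal this]
  obtain ⟨n, hn⟩ := hby
  obtain ⟨r, hr⟩ := Ideal.mem_span_singleton.mp hn
  have hyK : (y : K) ≠ 0 := ZeroMemClass.coe_eq_zero.not.mpr hy0
  have hrK : (c⁻¹) ^ n = (y : K) * r := by
    rw [← hb]
    exact congrArg Subtype.val hr
  have hc0 : c ≠ 0 := by rintro rfl; exact hcB (zero_mem _)
  have hinv : (y : K)⁻¹ = r * c ^ n := by
    rw [inv_pow] at hrK
    field_simp at hrK ⊢
    exact hrK
  rw [div_eq_mul_inv]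
  exact mul_mem (h x.2) (hinv ▸ mul_mem (h r.2) (pow_mem hc n))

theorem toSubring_ne_top (V : ValuationSubring K) [IsDiscreteValuationRing V] :
    V.toSubring ≠ ⊤ := by
  intro h
  have hmem (x : K) : x ∈ V := V.mem_toSubring x |>.mp (h ▸ Subring.mem_top x)
  refine IsDiscreteValuationRing.not_isField V ⟨⟨0, 1, zero_ne_one⟩, mul_comm, fun {x} hx => ?_⟩
  exact ⟨⟨(x : K)⁻¹, hmem _⟩, Subtype.ext (mul_inv_cancel₀ (ZeroMemClass.coe_eq_zero.not.mpr hx))⟩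

theorem inv_notMem_of_mem_maximalIdeal {S T : LocalSubring K} (h : S ≤ T) {a : S.toSubring}
    (ha : a ∈ maximalIdeal S.toSubring) (ha0 : (a : K) ≠ 0) : (a : K)⁻¹ ∉ T.toSubring := fun h' =>
  mem_maximalIdeal_iff_inv_notMem.mp ha ha0 ((le_iff_inv_mem.mp h).2 a a.2 ha0 h')

variable {S T W : LocalSubring K}

theorem pow_notMem_pow_succ {R B : Subring K} (hR : R ≤ B) {a : R} (ha0 : (a : K) ≠ 0)
    {I : Ideal R} (h : ∀ b ∈ I, (b : K) / a ∈ B) (hinv : (a : K)⁻¹ ∉ B) (n : ℕ) :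
    a ^ n ∉ I ^ (n + 1) := by
  intro hmem
  have hdiv := div_pow_mem_of_mem_pow hR h hmem
  have heq : ((a ^ n : R) : K) / (a : K) ^ (n + 1) = (a : K)⁻¹ := by
    push_cast
    rw [pow_succ]
    field_simp
  exact hinv (heq ▸ hdiv)

theorem IsLocalQuadraticTransform.isRegularLocalRing [IsRegularLocalRing S.toSubring]
    (h : IsLocalQuadraticTransform S T) : IsRegularLocalRing T.toSubring := by
  obtain ⟨⟨a, ha, ha0, hT⟩, hST⟩ := h
  have ha0' : (a : K) ≠ 0 := ZeroMemClass.coe_eq_zero.not.mpr ha0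
  have hinv := inv_notMem_of_mem_maximalIdeal hST ha ha0'
  have ha2 : a ∉ maximalIdeal S.toSubring ^ 2 := by
    simpa using pow_notMem_pow_succ le_blowupChart ha0' (fun b hb => div_mem_blowupChart hb)
      (fun h => hinv (le_of_mem_affineModel hT h)) 1
  exact isRegularLocalRing_of_mem_affineModel_blowupChart ha ha2 hT hinv

section Localizations

variable {R : Subring K} {I : Ideal R} {a : R}

theorem mem_affineModel_of_inv_mem (ha : a ∈ I) (ha0 : (a : K) ≠ 0)
    (hW : W ∈ affineModel (blowupChart R I a)) (hinv : (a : K)⁻¹ ∈ W.toSubring) :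
    W ∈ affineModel R := by
  refine mem_affineModel_iff.mpr ⟨le_blowupChart.trans (le_of_mem_affineModel hW), fun x hx => ?_⟩
  obtain ⟨u, hu, v, hv, hv0, hvi, rfl⟩ := (mem_affineModel_iff.mp hW).2 x hx
  obtain ⟨j, f, -, rfl⟩ := exists_eq_div_pow_of_mem_blowupChart ha ha0 hu
  obtain ⟨k, g, -, rfl⟩ := exists_eq_div_pow_of_mem_blowupChart ha ha0 hv
  obtain ⟨hg0, -⟩ := div_ne_zero_iff.mp hv0
  refine ⟨f * (a : K) ^ k, mul_mem f.2 (pow_mem a.2 k), g * (a : K) ^ j,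
    mul_mem g.2 (pow_mem a.2 j), mul_ne_zero hg0 (pow_ne_zero j ha0), ?_, by field_simp⟩
  have hga : ((g : K) * (a : K) ^ j)⁻¹ =
      ((g : K) / (a : K) ^ k)⁻¹ * (a : K)⁻¹ ^ k * (a : K)⁻¹ ^ j := by
    rw [inv_pow, inv_pow]
    field_simp
  rw [hga]
  exact mul_mem (mul_mem hvi (pow_mem hinv k)) (pow_mem hinv j)

end Localizations

theorem div_mem_ordRing {f g : S.toSubring} {k : ℕ} (hf : f ∈ maximalIdeal S.toSubring ^ k)
    (hg : g ∉ maximalIdeal S.toSubring ^ (k + 1)) : (f : K) / g ∈ ordRing S := by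
  refine ⟨f, g, by rintro rfl; exact hg (zero_mem _), rfl, fun n hn => ?_⟩
  obtain hkn | hnk := Nat.lt_or_ge k n
  · exact absurd (Ideal.pow_le_pow_right hkn hn) hg
  · exact Ideal.pow_le_pow_right hnk hf

theorem toSubring_le_of_eq_ordRing {a : S.toSubring} (ha : a ∈ maximalIdeal S.toSubring)
    (ha0 : (a : K) ≠ 0) {V : ValuationSubring K} (hV : (V : Set K) = ordRing S)
    (hW : W ∈ affineModel (blowupChart S.toSubring (maximalIdeal S.toSubring) a))
    (hinv : (a : K)⁻¹ ∉ W.toSubring) : W.toSubring ≤ V.toSubring := by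
  have hmem {x : K} (hx : x ∈ ordRing S) : x ∈ V.toSubring := hV.symm.subset hx
  have hle := le_of_mem_affineModel hW
  have hdiv (b : S.toSubring) (hb : b ∈ maximalIdeal S.toSubring) : (b : K) / a ∈ W.toSubring :=
    hle (div_mem_blowupChart hb)
  intro x hx
  obtain ⟨u, hu, v, hv, hv0, hvi, rfl⟩ := (mem_affineModel_iff.mp hW).2 x hx
  obtain ⟨j, f, hf, rfl⟩ := exists_eq_div_pow_of_mem_blowupChart ha ha0 hu
  obtain ⟨k, g, -, rfl⟩ := exists_eq_div_pow_of_mem_blowupChart ha ha0 hv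
  obtain ⟨hg0, -⟩ := div_ne_zero_iff.mp hv0
  have hgk : g ∉ maximalIdeal S.toSubring ^ (k + 1) := fun hg' => by
    have hga := div_pow_mem_of_mem_pow (le_blowupChart.trans hle) hdiv hg'
    have heq : (a : K)⁻¹ = ((g : K) / (a : K) ^ k)⁻¹ * ((g : K) / (a : K) ^ (k + 1)) := by
      rw [pow_succ]
      field_simp
    exact hinv (heq ▸ mul_mem hvi hga)
  have haj := pow_notMem_pow_succ (le_blowupChart.trans hle) ha0 hdiv hinv j
  rw [div_div_eq_mul_div, mul_div_assoc]
  exact mul_mem (hmem (by simpa using div_mem_ordRing hf haj))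
    (hmem (by simpa using div_mem_ordRing (Ideal.pow_mem_pow ha k) hgk))

theorem IsLocalQuadraticTransform.eq_or_mem_affineModel [IsFractionRing S.toSubring K]
    (h : IsLocalQuadraticTransform S T) {V : ValuationSubring K} [IsDiscreteValuationRing V]
    (hV : (V : Set K) = ordRing S) (hW : W ∈ affineModel T.toSubring)
    [IsDiscreteValuationRing W.toSubring] :
    W = V.toLocalSubring ∨ W ∈ affineModel S.toSubring := by
  obtain ⟨⟨a, ha, ha0, hT⟩, -⟩ := h
  have ha0' : (a : K) ≠ 0 := ZeroMemClass.coe_eq_zero.not.mpr ha0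
  have hWA := mem_affineModel_trans hT hW
  by_cases hinv : (a : K)⁻¹ ∈ W.toSubring
  · exact .inr (mem_affineModel_of_inv_mem ha ha0' hWA hinv)
  · have := isFractionRing_of_le (K := K) (le_blowupChart.trans (le_of_mem_affineModel hWA))
    exact .inl (LocalSubring.toSubring_injective (eq_of_isDiscreteValuationRing_le
      (toSubring_le_of_eq_ordRing ha ha0' hV hWA hinv) (toSubring_ne_top V)).symm)

theorem exists_forall_div_mem (V : ValuationSubring K) {R : Subring K} (hR : R ≤ V.toSubring)
    {I : Ideal R} (hI : I.FG) (hI0 : I ≠ ⊥) :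
    ∃ a ∈ I, (a : K) ≠ 0 ∧ ∀ b ∈ I, (b : K) / a ∈ V.toSubring := by
  obtain ⟨s, rfl⟩ := hI
  have hne : s.Nonempty := by
    rw [Finset.nonempty_iff_ne_empty]
    rintro rfl
    simp at hI0
  obtain ⟨a, has, hmax⟩ := s.exists_max_image (fun x => V.valuation (x : K)) hne
  have ha0 : (a : K) ≠ 0 := by
    intro h0
    refine hI0 (Submodule.span_eq_bot.mpr fun x hx => ?_)
    have hxa := hmax x hx
    rw [h0, map_zero, le_zero_iff, map_eq_zero] at hxa
    exact Subtype.ext hxa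
  refine ⟨a, Submodule.subset_span has, ha0, fun b hb => ?_⟩
  induction hb using Submodule.span_induction with
  | mem x hx =>
    rw [ValuationSubring.mem_toSubring, ← V.valuation_le_one_iff, map_div₀]
    exact div_le_one_of_le₀ (hmax x hx) zero_le
  | zero => simp
  | add x y _ _ hx hy => rw [Subring.coe_add, add_div]; exact add_mem hx hy
  | smul r x _ hx =>
    rw [smul_eq_mul, Subring.coe_mul, mul_div_assoc]
    exact mul_mem (hR r.2) hx

theorem exists_isLocalQuadraticTransform_le [IsNoetherianRing S.toSubring]
    (hm : maximalIdeal S.toSubring ≠ ⊥) {V : ValuationSubring K} (hV : S ≤ V.toLocalSubring) :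
    ∃ T, IsLocalQuadraticTransform S T ∧ T ≤ V.toLocalSubring := by
  obtain ⟨a, ha, ha0, hdiv⟩ := exists_forall_div_mem V hV.1 (IsNoetherian.noetherian _) hm
  obtain ⟨T, hT, hTV⟩ := exists_mem_affineModel_le (V := V.toLocalSubring)
    (blowupChart_le hV.1 hdiv)
  refine ⟨T, ⟨⟨a, ha, ZeroMemClass.coe_eq_zero.not.mp ha0, hT⟩, ?_⟩, hTV⟩
  rw [le_iff_inv_mem] at hV ⊢
  exact ⟨le_blowupChart.trans (le_of_mem_affineModel hT),
    fun x hx hx0 hxT => hV.2 x hx hx0 (hTV.1 hxT)⟩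

theorem IsLocalQuadraticTransform.ne [IsNoetherianRing S.toSubring]
    (hd : 2 ≤ ringKrullDim S.toSubring) (h : IsLocalQuadraticTransform S T) : T ≠ S := by
  rintro rfl
  obtain ⟨⟨a, ha, ha0, hT⟩, -⟩ := h
  have hm : maximalIdeal T.toSubring = Ideal.span (Set.range fun _ : Fin 1 => a) := by
    rw [Set.range_const]
    refine le_antisymm (fun b hb => ?_) ((Ideal.span_singleton_le_iff_mem _).mpr ha)
    refine Ideal.mem_span_singleton'.mpr
      ⟨⟨_, le_of_mem_affineModel hT (div_mem_blowupChart hb)⟩, Subtype.ext ?_⟩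
    exact div_mul_cancel₀ _ (ZeroMemClass.coe_eq_zero.not.mpr ha0)
  exact absurd (hd.trans (ringKrullDim_le_of_span_range hm.symm)) (by decide)

end QuadraticTransform

/-! ### The saturated regular model -/

section SaturatedModel

variable {K : Type*} [Field K] {R : LocalSubring K} {Γ : Set (LocalSubring K)} {n : ℕ}
  {T : LocalSubring K}

theorem mem_iterate_blowupPoints_succ :
    T ∈ (blowupPoints Γ)^[n + 1] (affineModel R.toSubring) ↔
      (T ∈ (blowupPoints Γ)^[n] (affineModel R.toSubring) ∧ T ∉ Γ) ∨
      ∃ S ∈ (blowupPoints Γ)^[n] (affineModel R.toSubring), S ∈ Γ ∧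
        IsLocalQuadraticTransform S T := by
  rw [Function.iterate_succ_apply']
  rfl

theorem le_of_mem_iterate_blowupPoints
    (hT : T ∈ (blowupPoints Γ)^[n] (affineModel R.toSubring)) : R.toSubring ≤ T.toSubring := by
  induction n generalizing T with
  | zero => exact le_of_mem_affineModel hT
  | succ n ih =>
    obtain ⟨hT, -⟩ | ⟨S, hS, -, hST⟩ := mem_iterate_blowupPoints_succ.mp hT
    · exact ih hT
    · exact (ih hS).trans hST.2.1

theorem isRegularLocalRing_of_mem_affineModel [IsRegularLocalRing R.toSubring]
    (hT : T ∈ affineModel R.toSubring) : IsRegularLocalRing T.toSubring := by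
  obtain ⟨P, hP, rfl⟩ := hT
  have := isRegularLocalRing_localization P
  exact .of_ringEquiv (LocalSubring.ofPrimeEquiv R.toSubring P).toRingEquiv

theorem isRegularLocalRing_of_mem_iterate_blowupPoints [IsRegularLocalRing R.toSubring]
    (hT : T ∈ (blowupPoints Γ)^[n] (affineModel R.toSubring)) :
    IsRegularLocalRing T.toSubring := by
  induction n generalizing T with
  | zero => exact isRegularLocalRing_of_mem_affineModel hT
  | succ n ih =>
    obtain ⟨hT, -⟩ | ⟨S, hS, -, hST⟩ := mem_iterate_blowupPoints_succ.mp hT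
    · exact ih hT
    · have := ih hS
      exact hST.isRegularLocalRing

theorem mem_affineModel_or_eq_of_mem_iterate_blowupPoints [IsFractionRing R.toSubring K]
    {E : Set (ValuationSubring K)} (hE : ∀ V ∈ E, IsDiscreteValuationRing V)
    (hΓ : ∀ S ∈ Γ, ∃ V ∈ E, (V : Set K) = ordRing S)
    (hT : T ∈ (blowupPoints Γ)^[n] (affineModel R.toSubring)) {W : LocalSubring K}
    (hW : W ∈ affineModel T.toSubring) [IsDiscreteValuationRing W.toSubring] :
    W ∈ affineModel R.toSubring ∨ ∃ V ∈ E, W = V.toLocalSubring := by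
  induction n generalizing T with
  | zero => exact .inl (mem_affineModel_trans hT hW)
  | succ n ih =>
    obtain ⟨hT, -⟩ | ⟨S, hS, hSΓ, hST⟩ := mem_iterate_blowupPoints_succ.mp hT
    · exact ih hT hW
    · obtain ⟨V, hVE, hV⟩ := hΓ S hSΓ
      have := hE V hVE
      have := isFractionRing_of_le (K := K) (le_of_mem_iterate_blowupPoints hS)
      obtain h | h := hST.eq_or_mem_affineModel hV hW
      · exact .inr ⟨V, hVE, h⟩
      · exact ih hS h

theorem mem_saturatedModel_of_notMem
    (hT : T ∈ (blowupPoints Γ)^[n] (affineModel R.toSubring)) (hTΓ : T ∉ Γ) :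
    T ∈ saturatedModel R Γ := by
  refine ⟨n, fun m hm => ?_⟩
  induction m, hm using Nat.le_induction with
  | base => exact hT
  | succ m _ ih => exact mem_iterate_blowupPoints_succ.mpr (.inl ⟨ih, hTΓ⟩)

theorem maximalIdeal_ne_bot_of_two_le_ringKrullDim {A : Type*} [CommRing A] [IsLocalRing A]
    [IsNoetherianRing A] (h : 2 ≤ ringKrullDim A) : maximalIdeal A ≠ ⊥ := by
  intro hm
  have hdim := ringKrullDim_le_of_span_range (y := (Fin.elim0 : Fin 0 → A)) (by simp [hm])
  exact absurd (h.trans hdim) (by decide)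

-- The number of points of `Γ` dominating the centre of `V` drops with every blowup of the centre.
theorem exists_mem_saturatedModel_le_of_mem_iterate_blowupPoints [IsRegularLocalRing R.toSubring]
    (hfin : Γ.Finite) (hd : ∀ S ∈ Γ, 2 ≤ ringKrullDim S.toSubring) {V : ValuationSubring K}
    (hT : T ∈ (blowupPoints Γ)^[n] (affineModel R.toSubring)) (hTV : T ≤ V.toLocalSubring) :
    ∃ T ∈ saturatedModel R Γ, T ≤ V.toLocalSubring := by
  induction hk : {S ∈ Γ | T ≤ S}.ncard using Nat.strong_induction_on generalizing n T with
  | _ k ih =>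
  by_cases hTΓ : T ∈ Γ
  · have := isRegularLocalRing_of_mem_iterate_blowupPoints hT
    obtain ⟨T', hT', hT'V⟩ := exists_isLocalQuadraticTransform_le
      (maximalIdeal_ne_bot_of_two_le_ringKrullDim (hd T hTΓ)) hTV
    have hssub : {S ∈ Γ | T' ≤ S} ⊂ {S ∈ Γ | T ≤ S} := by
      refine ⟨fun S hS => ⟨hS.1, hT'.2.trans hS.2⟩, fun hsub => ?_⟩
      have hT'T : T' ≤ T := (hsub ⟨hTΓ, le_rfl⟩).2
      exact hT'.ne (hd T hTΓ) (le_antisymm hT'T hT'.2)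
    exact ih _ (hk ▸ Set.ncard_lt_ncard hssub (hfin.subset (Set.sep_subset _ _)))
      (mem_iterate_blowupPoints_succ.mpr (.inr ⟨T, hT, hTΓ, hT'⟩)) hT'V rfl
  · exact ⟨T, mem_saturatedModel_of_notMem hT hTΓ, hTV⟩

theorem exists_mem_saturatedModel_le [IsRegularLocalRing R.toSubring] (hfin : Γ.Finite)
    (hd : ∀ S ∈ Γ, 2 ≤ ringKrullDim S.toSubring) {V : ValuationSubring K}
    (hV : R.toSubring ≤ V.toSubring) : ∃ T ∈ saturatedModel R Γ, T ≤ V.toLocalSubring := by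
  obtain ⟨T, hT, hTV⟩ := exists_mem_affineModel_le (V := V.toLocalSubring) hV
  exact exists_mem_saturatedModel_le_of_mem_iterate_blowupPoints (n := 0) hfin hd hT hTV

end SaturatedModel

/-! ### Integral closures of ideals and Rees valuations -/

section IntegralClosure

open Polynomial

variable {K : Type*} [Field K] {R : Subring K}

theorem isIntegralOverIdeal_of_aeval_inv_eq_one {J : Ideal R} {x : R} (hx : (x : K) ≠ 0)
    {p : R[X]} (hp : ∀ i, p.coeff i ∈ J ^ i) (hp0 : p.coeff 0 = 0)
    (hp1 : aeval (x : K)⁻¹ p = 1) : IsIntegralOverIdeal J x := by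
  refine ⟨p.natDegree, ?_, fun i => -p.coeff i, fun i _ => neg_mem (hp i), Subtype.ext ?_⟩
  · rw [Nat.pos_iff_ne_zero]
    intro h
    rw [eq_C_of_natDegree_eq_zero h, hp0] at hp1
    simp at hp1
  have hterm (i : ℕ) (hi : i ∈ Finset.Icc 1 p.natDegree) :
      -(p.coeff i : K) * (x : K) ^ (p.natDegree - i) =
        -((x : K) ^ p.natDegree * ((p.coeff i : K) * (x : K)⁻¹ ^ i)) := by
    rw [pow_sub₀ _ hx (Finset.mem_Icc.mp hi).2, inv_pow]
    ring
  have hsum : ∑ i ∈ Finset.Icc 1 p.natDegree, (p.coeff i : K) * (x : K)⁻¹ ^ i = 1 := by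
    rw [aeval_eq_sum_range, Finset.sum_range_succ', hp0, zero_smul, add_zero] at hp1
    rw [← hp1, Finset.range_eq_Ico, Finset.sum_Ico_add' (fun i => p.coeff i • (x : K)⁻¹ ^ i)]
    rfl
  push_cast
  rw [Finset.sum_congr rfl hterm, Finset.sum_neg_distrib, ← Finset.mul_sum, hsum, mul_one,
    add_neg_cancel]

-- `V` dominates the local ring of `R[J/x]` at a maximal ideal containing `J/x`.
theorem exists_valuationSubring_div_notMem {J : Ideal R} {x : K} (hx : x ≠ 0)
    (h : ∀ p : R[X], (∀ i, p.coeff i ∈ J ^ i) → p.coeff 0 = 0 → aeval x⁻¹ p ≠ 1) :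
    ∃ V : ValuationSubring K, R ≤ V.toSubring ∧
      ∀ j ∈ J, (j : K) ≠ 0 → x / (j : K) ∉ V.toSubring := by
  let φ : reesAlgebra J →ₐ[R] K := (aeval x⁻¹).comp (reesAlgebra J).val
  let B : Subring K := φ.toRingHom.range
  let ρ : reesAlgebra J →+* B := φ.toRingHom.rangeRestrict
  let irrel : Ideal (reesAlgebra J) :=
    RingHom.ker (constantCoeff.comp (reesAlgebra J).val.toRingHom)
  have hproper : irrel.map ρ ≠ ⊤ := by
    intro htop
    obtain ⟨p, hp, hp1⟩ := (Ideal.mem_map_iff_of_surjective ρ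
      (RingHom.rangeRestrict_surjective _)).mp ((Ideal.eq_top_iff_one _).mp htop)
    exact h p (fun i => (mem_reesAlgebra_iff J p).mp p.2 i) hp (congrArg Subtype.val hp1)
  obtain ⟨M, hM, hle⟩ := Ideal.exists_le_maximal _ hproper
  obtain ⟨V, hV⟩ := LocalSubring.exists_le_valuationSubring (LocalSubring.ofPrime B M)
  have hRB : R ≤ B := fun r hr => ⟨algebraMap R _ ⟨r, hr⟩, φ.commutes _⟩
  refine ⟨V, hRB.trans ((LocalSubring.le_ofPrime B M).trans hV.1), fun j hj hj0 hjV => ?_⟩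
  let q : reesAlgebra J := ⟨monomial 1 j, reesAlgebra.monomial_mem.mpr (by simpa using hj)⟩
  have hq : (ρ q : K) = (j : K) / x := by
    change aeval x⁻¹ (monomial 1 j) = _
    rw [aeval_monomial, pow_one, div_eq_mul_inv]
    rfl
  have hqM : ρ q ∈ M := hle (Ideal.mem_map_of_mem ρ (coeff_monomial_of_ne j zero_ne_one))
  have hq0 : (ρ q : K) ≠ 0 := hq ▸ div_ne_zero hj0 hx
  refine (inv_mem_ofPrime_iff hq0).mp ?_ hqM
  refine (le_iff_inv_mem.mp hV).2 _ (LocalSubring.le_ofPrime B M (ρ q).2) hq0 ?_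
  rwa [hq, inv_div]

theorem isIntegralOverIdeal_of_forall_valuationSubring {J : Ideal R} {x : R}
    (h : ∀ V : ValuationSubring K, R ≤ V.toSubring →
      ∃ j ∈ J, (j : K) ≠ 0 ∧ (x : K) / (j : K) ∈ V.toSubring) : IsIntegralOverIdeal J x := by
  obtain hx | hx := eq_or_ne x 0
  · exact ⟨1, one_pos, 0, fun i _ => zero_mem _, by simp [hx]⟩
  have hx' : (x : K) ≠ 0 := ZeroMemClass.coe_eq_zero.not.mpr hx
  by_contra hnot
  obtain ⟨V, hRV, hV⟩ := exists_valuationSubring_div_notMem (J := J) hx'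
    fun p hp hp0 hp1 => hnot (isIntegralOverIdeal_of_aeval_inv_eq_one hx' hp hp0 hp1)
  obtain ⟨j, hj, hj0, hjV⟩ := h V hRV
  exact hV j hj hj0 hjV

variable {I : Ideal R} {a : R} {B : Subring K} {n : ℕ}

theorem exists_mem_extendIdeal_pow_iff (hR : R ≤ B) (ha : a ∈ I) (ha0 : (a : K) ≠ 0)
    (h : ∀ b ∈ I, (b : K) / a ∈ B) {x : K} :
    (∃ y ∈ extendIdeal (I ^ n) B, (y : K) = x) ↔ x / (a : K) ^ n ∈ B := by
  constructor
  · rintro ⟨y, hy, rfl⟩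
    induction hy using Submodule.span_induction with
    | mem s hs =>
      obtain ⟨r, hr, hrs⟩ := hs
      exact hrs ▸ div_pow_mem_of_mem_pow hR h hr
    | zero => simp
    | add x y _ _ hx hy => rw [Subring.coe_add, add_div]; exact add_mem hx hy
    | smul r x _ hx =>
      rw [smul_eq_mul, Subring.coe_mul, mul_div_assoc]
      exact mul_mem r.2 hx
  · intro hx
    refine ⟨⟨_, hx⟩ * ⟨(a : K) ^ n, pow_mem (hR a.2) n⟩, Ideal.mul_mem_left _ _
      (Ideal.subset_span ⟨a ^ n, Ideal.pow_mem_pow ha n, by push_cast; rfl⟩), ?_⟩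
    exact div_mul_cancel₀ _ (pow_ne_zero n ha0)

theorem isIntegral_div_pow_of_isIntegralOverIdeal (hR : R ≤ B)
    (h : ∀ b ∈ I, (b : K) / a ∈ B) {x : R} (hx : IsIntegralOverIdeal (I ^ n) x) :
    IsIntegral B ((x : K) / (a : K) ^ n) := by
  obtain ⟨N, -, c, hc, heq⟩ := hx
  have exists_coeff (i : ℕ) (hi : i ∈ Finset.Icc 1 N) :
      ∃ d : B, (d : K) = (c i : K) / (a : K) ^ (n * i) :=
    ⟨⟨_, div_pow_mem_of_mem_pow hR h (pow_mul I n i ▸ hc i hi)⟩, rfl⟩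
  choose! d hd using exists_coeff
  refine ⟨X ^ N + ∑ i ∈ Finset.Icc 1 N, C (d i) * X ^ (N - i), monic_X_pow_add ?_, ?_⟩
  · refine mem_degreeLT.mp (sum_mem fun i hi => mem_degreeLT.mpr ?_)
    refine (degree_C_mul_X_pow_le _ _).trans_lt ?_
    rw [Finset.mem_Icc] at hi
    exact_mod_cast (by omega : N - i < N)
  · have heqK : (x : K) ^ N + ∑ i ∈ Finset.Icc 1 N, (c i : K) * (x : K) ^ (N - i) = 0 := by
      exact_mod_cast congrArg Subtype.val heq
    have hterm (i : ℕ) (hi : i ∈ Finset.Icc 1 N) :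
        (d i : K) * ((x : K) / (a : K) ^ n) ^ (N - i) =
          (c i : K) * (x : K) ^ (N - i) / (a : K) ^ (n * N) := by
      rw [hd i hi, div_pow, ← pow_mul, div_mul_div_comm, ← pow_add, ← mul_add,
        Nat.add_sub_cancel' (Finset.mem_Icc.mp hi).2]
    rw [eval₂_add, eval₂_X_pow, eval₂_finsetSum]
    simp only [eval₂_mul, eval₂_C, eval₂_X_pow]
    have hlead : ((x : K) / (a : K) ^ n) ^ N = (x : K) ^ N / (a : K) ^ (n * N) := by
      rw [div_pow, ← pow_mul]
    refine (congrArg₂ (· + ·) hlead (Finset.sum_congr rfl hterm)).trans ?_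
    rw [← Finset.sum_div, ← add_div, heqK, zero_div]

theorem div_pow_mem_of_isIntegralOverIdeal [IsIntegrallyClosed B] [IsFractionRing B K]
    (hR : R ≤ B) (h : ∀ b ∈ I, (b : K) / a ∈ B) {x : R}
    (hx : IsIntegralOverIdeal (I ^ n) x) : (x : K) / (a : K) ^ n ∈ B := by
  obtain ⟨y, hy⟩ := IsIntegrallyClosed.isIntegral_iff.mp
    (isIntegral_div_pow_of_isIntegralOverIdeal hR h hx)
  exact hy ▸ y.2

end IntegralClosure

section Proportional

variable {M ι : Type*} [AddCommMonoid M]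

theorem mul_le_mul_of_forall_le {v w : M →+ ℤ} {c d : ℤ} (hv : ∀ y, 0 ≤ v y) (hc : 0 ≤ c)
    (h : ∀ (y : M) (m : ℕ), m * c ≤ v y → m * d ≤ w y) (y : M) : v y * d ≤ c * w y := by
  lift c to ℕ using hc
  have := h (c • y) (v y).toNat (by
    rw [map_nsmul, nsmul_eq_mul, Int.toNat_of_nonneg (hv y), mul_comm])
  rwa [map_nsmul, nsmul_eq_mul, Int.toNat_of_nonneg (hv y)] at this

theorem exists_forall_mul_lt_mul {E : Finset ι} {v : M →+ ℤ} {w : ι → M →+ ℤ} {c : ι → ℤ} {c₀ : ℤ}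
    (hle : ∀ i ∈ E, ∀ y, v y * c i ≤ c₀ * w i y)
    (hne : ∀ i ∈ E, 0 < c i → ∃ y, v y * c i ≠ c₀ * w i y) :
    ∃ z, ∀ i ∈ E, 0 < c i → v z * c i < c₀ * w i z := by
  classical
  choose! y hy using hne
  refine ⟨∑ j ∈ E, y j, fun i hi hci => ?_⟩
  rw [← Finset.add_sum_erase E y hi, map_add, map_add, add_mul, mul_add]
  exact add_lt_add_of_lt_of_le ((hle i hi _).lt_of_ne (hy i hi hci)) (hle i hi _)

theorem exists_not_mul_lt_mul {E : Finset ι} {v : M →+ ℤ} {w : ι → M →+ ℤ} {c : ι → ℤ} {c₀ : ℤ}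
    (hv : ∀ y, 0 ≤ v y) (hw : ∀ i ∈ E, ∀ y, 0 ≤ w i y) (hc : 0 < c₀)
    (h : ∀ (y : M) (m : ℕ), (∀ i ∈ E, m * c i ≤ w i y) → m * c₀ ≤ v y) (z : M) :
    ∃ i ∈ E, 0 < c i ∧ ¬ v z * c i < c₀ * w i z := by
  by_contra! hlt
  lift c₀ to ℕ using hc.le
  obtain ⟨L, hL⟩ : ∃ L : ℕ, ∀ i ∈ E, c i ≤ L := by
    obtain ⟨L, hL⟩ := (E.image c).bddAbove
    exact ⟨L.toNat, fun i hi => (hL (Finset.mem_coe.mpr (Finset.mem_image_of_mem c hi))).trans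
      (Int.self_le_toNat L)⟩
  have hLv : (0 : ℤ) ≤ L * v z := mul_nonneg (Int.natCast_nonneg _) (hv z)
  have hbound (i : ι) (hi : i ∈ E) : (L * v z + 1) * c i ≤ c₀ * L * w i z := by
    by_cases hci : 0 < c i
    · have := mul_le_mul_of_nonneg_left (Int.add_one_le_of_lt (hlt i hi hci))
        (Int.natCast_nonneg L)
      linarith [hL i hi]
    · have hleft : (L * v z + 1) * c i ≤ 0 :=
        mul_nonpos_of_nonneg_of_nonpos (by linarith) (not_lt.mp hci)
      have hright : 0 ≤ c₀ * L * w i z := mul_nonneg (by positivity) (hw i hi z)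
      exact hleft.trans hright
  have hcontra := h ((c₀ * L) • z) (L * (v z).toNat + 1) fun i hi => by
    simpa [Int.toNat_of_nonneg (hv z)] using hbound i hi
  simp only [map_nsmul, nsmul_eq_mul, Nat.cast_add, Nat.cast_mul, Nat.cast_one,
    Int.toNat_of_nonneg (hv z)] at hcontra
  linarith

theorem exists_proportional {E : Finset ι} {v : M →+ ℤ} {w : ι → M →+ ℤ} {c : ι → ℤ} {c₀ : ℤ}
    (hv : ∀ y, 0 ≤ v y) (hw : ∀ i ∈ E, ∀ y, 0 ≤ w i y) (hc : 0 < c₀)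
    (h : ∀ (y : M) (m : ℕ), m * c₀ ≤ v y ↔ ∀ i ∈ E, m * c i ≤ w i y) :
    ∃ i ∈ E, 0 < c i ∧ ∀ y, v y * c i = c₀ * w i y := by
  by_contra! hne
  have hle (i : ι) (hi : i ∈ E) : ∀ y, v y * c i ≤ c₀ * w i y :=
    mul_le_mul_of_forall_le hv hc.le fun y m hy => (h y m).mp hy i hi
  obtain ⟨z, hz⟩ := exists_forall_mul_lt_mul hle hne
  obtain ⟨i, hi, hci, hnot⟩ := exists_not_mul_lt_mul hv hw hc (fun y m => (h y m).mpr) z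
  exact hnot (hz i hi hci)

end Proportional

section Rees

variable {K : Type*} [Field K] {R : Subring K} {I : Ideal R}

theorem exists_ord (B : Subring K) [IsDiscreteValuationRing B] [IsFractionRing B K] :
    ∃ w : Additive Kˣ →+ ℤ, ∀ x : Kˣ, (x : K) ∈ B ↔ 0 ≤ w (.ofMul x) := by
  let v := (IsDiscreteValuationRing.maximalIdeal B).valuation K
  have hv (x : Kˣ) : v x ≠ 0 := (map_ne_zero v).mpr x.ne_zero
  let w : Additive Kˣ →+ ℤ := AddMonoidHom.mk' (fun x => -WithZero.log (v (x.toMul : Kˣ)))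
    fun x y => by rw [toMul_add, Units.val_mul, map_mul, WithZero.log_mul (hv _) (hv _), neg_add]
  have hw (x : Kˣ) : 0 ≤ w (.ofMul x) ↔ v x ≤ 1 := by
    change 0 ≤ -WithZero.log (v x) ↔ _
    rw [neg_nonneg, ← WithZero.log_one, WithZero.log_le_log (hv x) one_ne_zero]
  refine ⟨w, fun x => Iff.trans ⟨fun hx => ?_, fun h => ?_⟩ (hw x).symm⟩
  · exact IsDedekindDomain.HeightOneSpectrum.valuation_le_one _ (⟨x, hx⟩ : B)
  · obtain ⟨a, ha⟩ := IsDiscreteValuationRing.exists_lift_of_le_one h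
    exact ha ▸ a.2

theorem exists_ord_extendIdeal [IsFractionRing R K] (hI : I.FG) (hI0 : I ≠ ⊥)
    {V : ValuationSubring K} (hR : R ≤ V.toSubring) (hV : IsDiscreteValuationRing V) :
    ∃ (w : Additive Kˣ →+ ℤ) (α : ℤ), (∀ x : Kˣ, (x : K) ∈ V.toSubring ↔ 0 ≤ w (.ofMul x)) ∧
      ∀ (n : ℕ) (x : Kˣ),
        (∃ y ∈ extendIdeal (I ^ n) V.toSubring, (y : K) = x) ↔ n * α ≤ w (.ofMul x) := by
  have : IsDiscreteValuationRing V.toSubring := hV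
  have : IsFractionRing V.toSubring K := isFractionRing_of_le hR
  obtain ⟨w, hw⟩ := exists_ord V.toSubring
  obtain ⟨a, ha, ha0, hdiv⟩ := exists_forall_div_mem V hR hI hI0
  let u := Units.mk0 (a : K) ha0
  refine ⟨w, w (.ofMul u), hw, fun n x => ?_⟩
  have hx : (x : K) / (a : K) ^ n = (x / u ^ n : Kˣ) := by simp [u]
  rw [exists_mem_extendIdeal_pow_iff hR ha ha0 hdiv, hx, hw, ofMul_div, ofMul_pow, map_sub,
    map_nsmul, nsmul_eq_mul, sub_nonneg]

theorem eq_of_forall_mul_eq [IsFractionRing R K] {V W : ValuationSubring K}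
    {v w : Additive Kˣ →+ ℤ} (hv : ∀ x : Kˣ, (x : K) ∈ V.toSubring ↔ 0 ≤ v (.ofMul x))
    (hw : ∀ x : Kˣ, (x : K) ∈ W.toSubring ↔ 0 ≤ w (.ofMul x)) {c d : ℤ} (hc : 0 < c) (hd : 0 < d)
    (h : ∀ x : Kˣ, (x : K) ∈ R → v (.ofMul x) * c = d * w (.ofMul x)) : V = W := by
  have hK (x : Kˣ) : v (.ofMul x) * c = d * w (.ofMul x) := by
    obtain ⟨a, b, hb, hab⟩ := IsFractionRing.div_surjective (A := R) (x : K)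
    have hb0 : (b : K) ≠ 0 := ZeroMemClass.coe_eq_zero.not.mpr (nonZeroDivisors.ne_zero hb)
    have ha0 : (a : K) ≠ 0 := fun ha => x.ne_zero (by
      rw [← hab, show algebraMap R K a = 0 from ha, zero_div])
    have hx : x = Units.mk0 (a : K) ha0 / Units.mk0 (b : K) hb0 := by
      ext
      rw [Units.val_div_eq_div_val]
      exact hab.symm
    have ha' := h (Units.mk0 (a : K) ha0) a.2
    have hb' := h (Units.mk0 (b : K) hb0) b.2
    rw [hx, ofMul_div, map_sub, map_sub, sub_mul, mul_sub, ha', hb']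
  ext z
  obtain rfl | hz := eq_or_ne z 0
  · exact iff_of_true (zero_mem _) (zero_mem _)
  change z ∈ V.toSubring ↔ z ∈ W.toSubring
  rw [← Units.val_mk0 hz, hv, hw, ← mul_nonneg_iff_of_pos_right hc, hK,
    mul_nonneg_iff_of_pos_left hd]

theorem exists_separating_of_minimal {F : Set (ValuationSubring K)}
    (hF : Minimal (DeterminesIntegralClosures R I) F) {V : ValuationSubring K} (hV : V ∈ F) :
    ∃ (n : ℕ) (x : R), (∀ W ∈ F, W ≠ V →
      ∃ y ∈ extendIdeal (I ^ n) W.toSubring, (y : K) = (x : K)) ∧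
      ¬ ∃ y ∈ extendIdeal (I ^ n) V.toSubring, (y : K) = (x : K) := by
  have hnot : ¬ DeterminesIntegralClosures R I (F \ {V}) := fun h =>
    (hF.le_of_le h Set.sdiff_subset hV).2 rfl
  by_contra! hcon
  refine hnot ⟨hF.1.finite.sdiff, fun W hW => hF.1.le W hW.1, fun W hW => hF.1.dvr W hW.1,
    fun n x => (hF.1.mem_iff n x).trans ⟨fun h W hW => h W hW.1, fun h W hW => ?_⟩⟩
  by_cases hWV : W = V
  · obtain ⟨y, hy⟩ := hcon n x fun W' hW' hne => h W' ⟨hW', hne⟩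
    exact hWV ▸ ⟨y, hy⟩
  · exact h W ⟨hW, hWV⟩

theorem exists_mem_extendIdeal_pow_mul (hI : I.FG) (hI0 : I ≠ ⊥) {W : ValuationSubring K}
    (hR : R ≤ W.toSubring) {n : ℕ} {x : R}
    (h : ∃ z ∈ extendIdeal (I ^ n) W.toSubring, (z : K) = (x : K)) (m : ℕ) (y : R) :
    ∃ z ∈ extendIdeal (I ^ (n * m)) W.toSubring, (z : K) = ((x ^ m * y : R) : K) := by
  obtain ⟨a, ha, ha0, hdiv⟩ := exists_forall_div_mem W hR hI hI0
  rw [exists_mem_extendIdeal_pow_iff hR ha ha0 hdiv] at h ⊢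
  push_cast
  rw [pow_mul, mul_div_right_comm, ← div_pow]
  exact mul_mem (pow_mem h m) (hR y.2)

theorem isIntegralOverIdeal_pow_mul_iff (hI : I.FG) (hI0 : I ≠ ⊥) {F : Set (ValuationSubring K)}
    (hF : DeterminesIntegralClosures R I F) {V : ValuationSubring K} (hV : V ∈ F) {n : ℕ} {x : R}
    (hx : ∀ W ∈ F, W ≠ V → ∃ z ∈ extendIdeal (I ^ n) W.toSubring, (z : K) = (x : K))
    (m : ℕ) (y : R) : IsIntegralOverIdeal (I ^ (n * m)) (x ^ m * y) ↔
      ∃ z ∈ extendIdeal (I ^ (n * m)) V.toSubring, (z : K) = ((x ^ m * y : R) : K) := by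
  rw [hF.mem_iff]
  refine ⟨fun h => h V hV, fun h W hW => ?_⟩
  by_cases hWV : W = V
  · exact hWV ▸ h
  · exact exists_mem_extendIdeal_pow_mul hI hI0 (hF.le W hW) (hx W hW hWV) m y

theorem subset_of_minimal [IsFractionRing R K] (hI : I.FG) (hI0 : I ≠ ⊥)
    {E F : Set (ValuationSubring K)} (hF : Minimal (DeterminesIntegralClosures R I) F)
    (hE : DeterminesIntegralClosures R I E) : F ⊆ E := by
  intro V hV
  obtain ⟨n, x, hxF, hxV⟩ := exists_separating_of_minimal hF hV
  have hx0 : (x : K) ≠ 0 := fun h => hxV ⟨0, Ideal.zero_mem _, h.symm⟩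
  let u := Units.mk0 (x : K) hx0
  have exists_data (W : ValuationSubring K) (hW : W ∈ F ∪ E) :=
    exists_ord_extendIdeal hI hI0 (hW.elim (hF.1.le W) (hE.le W))
      (hW.elim (hF.1.dvr W) (hE.dvr W))
  choose! w α hw hα using exists_data
  have hVU : V ∈ F ∪ E := Or.inl hV
  let P : AddSubmonoid (Additive Kˣ) := (R.toSubmonoid.comap (Units.coeHom K)).toAddSubmonoid
  have hnonneg (W : ValuationSubring K) (hW : W ∈ F ∪ E) (y : P) : 0 ≤ w W y :=
    (hw W hW y.1.toMul).mp (hW.elim (hF.1.le W) (hE.le W) y.2)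
  let c (W : ValuationSubring K) : ℤ := n * α W - w W (.ofMul u)
  have hcV : 0 < c V := sub_pos.mpr (not_le.mp ((hα V hVU n u).not.mp hxV))
  have hiff (W : ValuationSubring K) (hW : W ∈ F ∪ E) (y : P) (m : ℕ) : m * c W ≤ w W y ↔
      ∃ z ∈ extendIdeal (I ^ (n * m)) W.toSubring, (z : K) = (x : K) ^ m * (y.1.toMul : K) := by
    have := hα W hW (n * m) (u ^ m * y.1.toMul)
    rw [ofMul_mul, ofMul_pow, map_add, map_nsmul] at this
    refine Iff.trans ?_ this.symm
    simp only [c, nsmul_eq_mul, ofMul_toMul, Nat.cast_mul]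
    constructor <;> intro h <;> linarith
  obtain ⟨W, hWE, hcW, hprop⟩ := exists_proportional (E := hE.finite.toFinset)
    (v := (w V).comp P.subtype) (w := fun W => (w W).comp P.subtype) (c := c)
    (hnonneg V hVU) (fun W hW => hnonneg W (Or.inr (hE.finite.mem_toFinset.mp hW))) hcV
    fun y m => by
      -- Both conditions say that `x ^ m * y` is integral over `I ^ (n * m)`.
      have hV_iff := isIntegralOverIdeal_pow_mul_iff hI hI0 hF.1 hV hxF m ⟨_, y.2⟩
      refine (hiff V hVU y m).trans (hV_iff.symm.trans ((hE.mem_iff _ _).trans ?_))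
      exact forall_congr' fun W => by
        rw [hE.finite.mem_toFinset]
        exact forall_congr' fun hW => (hiff W (Or.inr hW) y m).symm
  rw [hE.finite.mem_toFinset] at hWE
  exact eq_of_forall_mul_eq (hw V hVU) (hw W (Or.inr hWE)) hcW hcV
    (fun y hy => hprop ⟨.ofMul y, hy⟩) ▸ hWE

end Rees

section Models

variable {K : Type*} [Field K] {R : Subring K} {Y : Set (LocalSubring K)} {S W : LocalSubring K}

theorem exists_toLocalSubring_eq (W : LocalSubring K) [IsDiscreteValuationRing W.toSubring]
    [IsFractionRing W.toSubring K] : ∃ V : ValuationSubring K, V.toLocalSubring = W := by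
  refine ⟨⟨W.toSubring, fun x => ?_⟩, LocalSubring.ext rfl⟩
  obtain ⟨y, hy⟩ | ⟨y, hy⟩ := ValuationRing.isInteger_or_isInteger W.toSubring x
  · exact Or.inl (hy ▸ y.2)
  · exact Or.inr (hy ▸ y.2)

theorem IsModel.exists_affineModel [IsNoetherianRing R] (hY : IsModel R Y) (hS : S ∈ Y) :
    ∃ A : Subring K, R ≤ A ∧ IsNoetherianRing A ∧ S ∈ affineModel A ∧ affineModel A ⊆ Y := by
  obtain ⟨F, -, hFG, rfl⟩ := hY.finite_union
  obtain ⟨A, hA, hSA⟩ := Set.mem_iUnion₂.mp hS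
  have : Algebra.FiniteType R A := (Subalgebra.fg_iff_finiteType A).mp (hFG A hA)
  exact ⟨A.toSubring, fun r hr => A.algebraMap_mem ⟨r, hr⟩,
    Algebra.FiniteType.isNoetherianRing R A, hSA,
    Set.subset_biUnion_of_mem (u := fun A : Subalgebra R K => affineModel A.toSubring) hA⟩

theorem IsModel.le [IsNoetherianRing R] (hY : IsModel R Y) (hS : S ∈ Y) : R ≤ S.toSubring := by
  obtain ⟨A, hRA, -, hSA, -⟩ := hY.exists_affineModel hS
  exact hRA.trans (le_of_mem_affineModel hSA)

theorem IsModel.isNoetherianRing [IsNoetherianRing R] (hY : IsModel R Y) (hS : S ∈ Y) :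
    IsNoetherianRing S.toSubring := by
  obtain ⟨A, -, hA, hSA, -⟩ := hY.exists_affineModel hS
  exact isNoetherianRing_of_mem_affineModel hSA

theorem IsModel.mem_of_mem_affineModel [IsNoetherianRing R] (hY : IsModel R Y) (hS : S ∈ Y)
    (hW : W ∈ affineModel S.toSubring) : W ∈ Y := by
  obtain ⟨A, -, -, hSA, hAY⟩ := hY.exists_affineModel hS
  exact hAY (mem_affineModel_trans hSA hW)

theorem IsModel.mem_affineModel_of_le [IsNoetherianRing R] (hY : IsModel R Y) (hS : S ∈ Y)
    {V : ValuationSubring K} (hV : V.toLocalSubring ∈ Y) (hSV : S.toSubring ≤ V.toSubring) :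
    V.toLocalSubring ∈ affineModel S.toSubring := by
  obtain ⟨T, hT, hTV⟩ := exists_mem_affineModel_le (V := V.toLocalSubring) hSV
  rwa [← hY.irredundant V (hY.le hV) T (hY.mem_of_mem_affineModel hS hT) _ hV hTV le_rfl]

end Models

section ModelsAndRees

variable {K : Type*} [Field K] {R : Subring K} {I : Ideal R} {Y : Set (LocalSubring K)}

theorem exists_forall_div_mem_of_mem_normalizedBlowup {S : LocalSubring K}
    (hS : S ∈ normalizedBlowup R I) :
    ∃ a ∈ I, (a : K) ≠ 0 ∧ ∀ b ∈ I, (b : K) / a ∈ S.toSubring := by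
  obtain ⟨a, ha, ha0, hSa⟩ := hS
  refine ⟨a, ha, ZeroMemClass.coe_eq_zero.not.mpr ha0, fun b hb => le_of_mem_affineModel hSa ?_⟩
  exact (integralClosure (blowupChart R I a) K).algebraMap_mem ⟨_, div_mem_blowupChart hb⟩

theorem HasMorphism.exists_forall_div_mem (h : HasMorphism Y (normalizedBlowup R I))
    {S : LocalSubring K} (hS : S ∈ Y) :
    ∃ a ∈ I, (a : K) ≠ 0 ∧ ∀ b ∈ I, (b : K) / a ∈ S.toSubring := by
  obtain ⟨S', hS', hle⟩ := h S hS
  obtain ⟨a, ha, ha0, hdiv⟩ := exists_forall_div_mem_of_mem_normalizedBlowup hS'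
  exact ⟨a, ha, ha0, fun b hb => hle.1 (hdiv b hb)⟩

theorem height_eq_one_of_isDiscreteValuationRing_ofPrime {A : Subring K} {P : Ideal A} [P.IsPrime]
    (h : IsDiscreteValuationRing (LocalSubring.ofPrime A P).toSubring) : P.height = 1 := by
  have hdim := IsLocalization.AtPrime.ringKrullDim_eq_height P
    (LocalSubring.ofPrime A P).toSubring
  rw [IsDiscreteValuationRing.ringKrullDim_eq_one] at hdim
  exact_mod_cast hdim.symm

/-- The discrete valuation rings on `Y` in which `I` extends to a proper ideal: the local rings of
`Y` at the components of codimension one of the closed set defined by `I`. -/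
def divisorialValuationRings (I : Ideal R) (Y : Set (LocalSubring K)) :
    Set (ValuationSubring K) :=
  {V | V.toLocalSubring ∈ Y ∧ IsDiscreteValuationRing V ∧
    ∀ b ∈ I, (b : K) ≠ 0 → (b : K)⁻¹ ∉ V.toSubring}

theorem mem_minimalPrimes_extendIdeal {A : Subring K} (hRA : R ≤ A) {P : Ideal A} [P.IsPrime]
    (hd : IsDiscreteValuationRing (LocalSubring.ofPrime A P).toSubring) (hI0 : I ≠ ⊥)
    (h : ∀ b ∈ I, (b : K) ≠ 0 → (b : K)⁻¹ ∉ (LocalSubring.ofPrime A P).toSubring) :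
    P ∈ (extendIdeal I A).minimalPrimes := by
  have hheight := height_eq_one_of_isDiscreteValuationRing_ofPrime hd
  have : P.FiniteHeight := P.finiteHeight_iff.mpr (Or.inr (by simp [hheight]))
  have hle : extendIdeal I A ≤ P := by
    refine Ideal.span_le.mpr ?_
    rintro s ⟨r, hr, hrs⟩
    obtain rfl | hs0 := eq_or_ne s 0
    · exact P.zero_mem
    · have hsK : (s : K) ≠ 0 := ZeroMemClass.coe_eq_zero.not.mpr hs0
      exact not_not.mp ((inv_mem_ofPrime_iff hsK).not.mp (hrs ▸ h r hr (hrs ▸ hsK)))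
  have hbot : extendIdeal I A ≠ ⊥ := by
    obtain ⟨b, hb, hb0⟩ := Submodule.exists_mem_ne_zero_of_ne_bot hI0
    refine (Submodule.ne_bot_iff _).mpr ⟨⟨b, hRA b.2⟩, Ideal.subset_span ⟨b, hb, rfl⟩, fun h => ?_⟩
    exact hb0 (Subtype.ext (congrArg (fun z : A => (z : K)) h))
  refine Ideal.mem_minimalPrimes_of_height_le hle (hheight ▸ ?_)
  exact Order.one_le_iff_ne_zero.mpr (Ideal.height_eq_zero_iff_eq_bot.not.mpr hbot)

theorem IsModel.finite_divisorialValuationRings [IsNoetherianRing R] (hY : IsModel R Y)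
    (hI0 : I ≠ ⊥) : (divisorialValuationRings I Y).Finite := by
  obtain ⟨F, hF, hFG, rfl⟩ := hY.finite_union
  have hfin : (⋃ A ∈ F, (fun p : PrimeSpectrum A => LocalSubring.ofPrime A.toSubring p.asIdeal) ''
      {p | p.asIdeal ∈ (extendIdeal I A.toSubring).minimalPrimes}).Finite := by
    refine hF.biUnion fun A hA => Set.Finite.image _ ?_
    have : Algebra.FiniteType R A := (Subalgebra.fg_iff_finiteType A).mp (hFG A hA)
    have : IsNoetherianRing A.toSubring := Algebra.FiniteType.isNoetherianRing R A
    exact (Ideal.finite_minimalPrimes_of_isNoetherianRing _ _).preimage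
      (fun p _ q _ hpq => PrimeSpectrum.ext hpq)
  refine (hfin.preimage (f := ValuationSubring.toLocalSubring)
    ValuationSubring.toLocalSubring_injective.injOn).subset ?_
  rintro V ⟨hVY, hVd, hVI⟩
  obtain ⟨A, hA, P, hP, hVA⟩ := Set.mem_iUnion₂.mp hVY
  have hVs : V.toSubring = (LocalSubring.ofPrime A.toSubring P).toSubring :=
    congrArg LocalSubring.toSubring hVA
  have hd : IsDiscreteValuationRing (LocalSubring.ofPrime A.toSubring P).toSubring := hVs ▸ hVd
  exact Set.mem_iUnion₂.mpr ⟨A, hA, ⟨P, hP⟩, mem_minimalPrimes_extendIdeal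
    (fun r hr => A.algebraMap_mem ⟨r, hr⟩) hd hI0 (hVs ▸ hVI), hVA.symm⟩

theorem div_pow_mem_of_inv_mem {B : Subring K} (hR : R ≤ B) {a b x : R}
    (hdiv : (b : K) / a ∈ B) (hb0 : (b : K) ≠ 0) (hb : (b : K)⁻¹ ∈ B) (n : ℕ) :
    (x : K) / (a : K) ^ n ∈ B := by
  have hinv : (a : K)⁻¹ ∈ B := by
    have := mul_mem hdiv hb
    rwa [div_mul_eq_mul_div, mul_inv_cancel₀ hb0, one_div] at this
  rw [div_eq_mul_inv, ← inv_pow]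
  exact mul_mem (hR x.2) (pow_mem hinv n)

theorem IsModel.div_pow_mem [IsFractionRing R K] [IsNoetherianRing R] (hY : IsModel R Y)
    {S : LocalSubring K} (hS : S ∈ Y) [IsIntegrallyClosed S.toSubring] {a : R} (ha : a ∈ I)
    (ha0 : (a : K) ≠ 0) (hdiv : ∀ b ∈ I, (b : K) / a ∈ S.toSubring) {n : ℕ} {x : R}
    (hx : ∀ V ∈ divisorialValuationRings I Y,
      ∃ y ∈ extendIdeal (I ^ n) V.toSubring, (y : K) = (x : K)) :
    (x : K) / (a : K) ^ n ∈ S.toSubring := by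
  have hRS := hY.le hS
  have := hY.isNoetherianRing hS
  have : IsFractionRing S.toSubring K := isFractionRing_of_le hRS
  refine mem_of_forall_isDiscreteValuationRing fun W hW hWd => ?_
  have hSW := le_of_mem_affineModel hW
  by_cases hWI : ∀ b ∈ I, (b : K) ≠ 0 → (b : K)⁻¹ ∉ W.toSubring
  · have : IsFractionRing W.toSubring K := isFractionRing_of_le hSW
    obtain ⟨V, rfl⟩ := exists_toLocalSubring_eq W
    exact (exists_mem_extendIdeal_pow_iff (hRS.trans hSW) ha ha0 fun b hb => hSW (hdiv b hb)).mp
      (hx V ⟨hY.mem_of_mem_affineModel hS hW, hWd, hWI⟩)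
  · push Not at hWI
    obtain ⟨b, hb, hb0, hbW⟩ := hWI
    exact div_pow_mem_of_inv_mem (hRS.trans hSW) (hSW (hdiv b hb)) hb0 hbW n

theorem IsCompleteModel.determinesIntegralClosures [IsFractionRing R K] [IsNoetherianRing R]
    (hY : IsCompleteModel R Y) (hYn : IsNormalModel Y)
    (hh : HasMorphism Y (normalizedBlowup R I)) (hI0 : I ≠ ⊥) :
    DeterminesIntegralClosures R I (divisorialValuationRings I Y) where
  finite := hY.finite_divisorialValuationRings hI0
  le V hV := hY.le hV.1
  dvr V hV := hV.2.1
  mem_iff n x := by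
    constructor
    · intro hx V hV
      have hR : R ≤ V.toSubring := hY.le hV.1
      obtain ⟨a, ha, ha0, hdiv⟩ := hh.exists_forall_div_mem hV.1
      have : IsIntegrallyClosed V.toSubring := inferInstanceAs (IsIntegrallyClosed V)
      have : IsFractionRing V.toSubring K := isFractionRing_of_le hR
      exact (exists_mem_extendIdeal_pow_iff hR ha ha0 hdiv).mpr
        (div_pow_mem_of_isIntegralOverIdeal hR hdiv hx)
    · intro hx
      refine isIntegralOverIdeal_of_forall_valuationSubring fun V hV => ?_
      obtain ⟨S, hS, hSV⟩ := hY.complete V hV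
      obtain ⟨a, ha, ha0, hdiv⟩ := hh.exists_forall_div_mem hS
      have := hYn S hS
      refine ⟨a ^ n, Ideal.pow_mem_pow ha n, by push_cast; exact pow_ne_zero n ha0, hSV.1 ?_⟩
      push_cast
      exact hY.div_pow_mem hS ha ha0 hdiv hx

theorem IsCompleteModel.ne_bot (hY : IsCompleteModel R Y)
    (hh : HasMorphism Y (normalizedBlowup R I)) : I ≠ ⊥ := by
  rintro rfl
  obtain ⟨S, hS, -⟩ := hY.complete ⊤ le_top
  obtain ⟨a, ha, ha0, -⟩ := hh.exists_forall_div_mem hS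
  exact ha0 (congrArg Subtype.val ((Ideal.mem_bot).mp ha))

theorem IsCompleteModel.reesValuationRings_subset [IsFractionRing R K] [IsNoetherianRing R]
    (hY : IsCompleteModel R Y) (hYn : IsNormalModel Y)
    (hh : HasMorphism Y (normalizedBlowup R I)) :
    reesValuationRings R I ⊆ divisorialValuationRings I Y := by
  rintro V ⟨F, hF, hVF⟩
  have hI0 := hY.ne_bot hh
  exact subset_of_minimal (IsNoetherian.noetherian I) hI0 hF
    (hY.determinesIntegralClosures hYn hh hI0) hVF

end ModelsAndRees

/-! ### Torsion divisor class groups -/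

section ClassGroup

theorem mem_maximalIdeal_pow_iff {B : Type*} [CommRing B] [IsDomain B] [IsDiscreteValuationRing B]
    {x : B} {n : ℕ} : x ∈ maximalIdeal B ^ n ↔ n ≤ IsDiscreteValuationRing.addVal B x := by
  obtain ⟨ϖ, hϖ⟩ := IsDiscreteValuationRing.exists_irreducible B
  rw [hϖ.maximalIdeal_eq, Ideal.span_singleton_pow, Ideal.mem_span_singleton,
    ← IsDiscreteValuationRing.addVal_le_iff_dvd, hϖ.addVal_pow]

variable {A : Type*} [CommRing A] [IsDomain A] [IsNoetherianRing A] [IsIntegrallyClosed A]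

instance HeightOnePrime.isDiscreteValuationRing (P : HeightOnePrime A) :
    IsDiscreteValuationRing (Localization.AtPrime P.1.asIdeal) :=
  isDiscreteValuationRing_of_height_eq_one P.1.asIdeal P.2 _

theorem coe_ordAt (P : HeightOnePrime A) {a : A} (ha : a ≠ 0) :
    (ordAt P a : ℕ∞) = IsDiscreteValuationRing.addVal (Localization.AtPrime P.1.asIdeal)
      (algebraMap A _ a) := by
  have ha' : algebraMap A (Localization.AtPrime P.1.asIdeal) a ≠ 0 :=
    IsLocalization.to_map_ne_zero_of_mem_nonZeroDivisors _
      P.1.asIdeal.primeCompl_le_nonZeroDivisors (mem_nonZeroDivisors_of_ne_zero ha)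
  obtain ⟨k, hk⟩ := ENat.ne_top_iff_exists.mp
    (mt IsDiscreteValuationRing.addVal_eq_top_iff.mp ha')
  have hIic : {n : ℕ | algebraMap A (Localization.AtPrime P.1.asIdeal) a ∈
      maximalIdeal (Localization.AtPrime P.1.asIdeal) ^ n} = Set.Iic k := by
    ext n
    rw [Set.mem_ofPred_eq, mem_maximalIdeal_pow_iff, ← hk, Nat.cast_le, Set.mem_Iic]
  rw [ordAt, hIic, csSup_Iic, hk]

theorem ordAt_mul (P : HeightOnePrime A) {a b : A} (ha : a ≠ 0) (hb : b ≠ 0) :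
    ordAt P (a * b) = ordAt P a + ordAt P b := by
  apply ENat.natCast_inj.mp
  rw [Nat.cast_add, coe_ordAt P ha, coe_ordAt P hb, coe_ordAt P (mul_ne_zero ha hb), map_mul,
    IsDiscreteValuationRing.addVal_mul]

theorem mem_iff_ordAt_pos (P : HeightOnePrime A) {a : A} (ha : a ≠ 0) :
    a ∈ P.1.asIdeal ↔ 0 < ordAt P a := by
  rw [← IsLocalization.AtPrime.to_map_mem_maximal_iff (Localization.AtPrime P.1.asIdeal)
      P.1.asIdeal, ← pow_one (maximalIdeal _), mem_maximalIdeal_pow_iff, ← coe_ordAt P ha]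
  norm_cast

theorem exists_notMem_dvd_mul_of_ordAt_le {a b : A} (ha : a ≠ 0) (hb : b ≠ 0)
    {P : HeightOnePrime A} (h : ordAt P b ≤ ordAt P a) : ∃ s ∉ P.1.asIdeal, b ∣ s * a := by
  rw [← ENat.natCast_le_natCast, coe_ordAt P hb, coe_ordAt P ha,
    IsDiscreteValuationRing.addVal_le_iff_dvd] at h
  obtain ⟨z, hz⟩ := h
  obtain ⟨⟨c, s⟩, hcs⟩ := IsLocalization.surj P.1.asIdeal.primeCompl z
  refine ⟨s, s.2, c, IsLocalization.injective (Localization.AtPrime P.1.asIdeal)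
    P.1.asIdeal.primeCompl_le_nonZeroDivisors ?_⟩
  rw [map_mul, map_mul, ← hcs, hz]
  ring

theorem dvd_of_forall_ordAt_le {a b : A} (ha : a ≠ 0) (hb : b ≠ 0)
    (h : ∀ P : HeightOnePrime A, ordAt P b ≤ ordAt P a) : b ∣ a := by
  by_contra hab
  obtain ⟨P, hP, hP1, hs⟩ := exists_height_eq_one_of_not_dvd hb hab
  obtain ⟨s, hsP, hdvd⟩ := exists_notMem_dvd_mul_of_ordAt_le ha hb (h ⟨⟨P, hP⟩, hP1⟩)
  exact hs s hsP hdvd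

theorem exists_of_mem_principalDivisors {D : HeightOnePrime A →₀ ℤ}
    (hD : D ∈ principalDivisors A) : ∃ a b : A, a ≠ 0 ∧ b ≠ 0 ∧
      ∀ P : HeightOnePrime A, D P = (ordAt P a : ℤ) - (ordAt P b : ℤ) := by
  induction hD using AddSubgroup.closure_induction with
  | mem _ h => exact h
  | zero => exact ⟨1, 1, one_ne_zero, one_ne_zero, fun P => by simp⟩
  | add D D' _ _ h h' =>
    obtain ⟨a, b, ha, hb, h⟩ := h
    obtain ⟨a', b', ha', hb', h'⟩ := h'
    refine ⟨a * a', b * b', mul_ne_zero ha ha', mul_ne_zero hb hb', fun P => ?_⟩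
    rw [ordAt_mul P ha ha', ordAt_mul P hb hb', Finsupp.add_apply, h, h']
    push_cast
    ring
  | neg D _ h =>
    obtain ⟨a, b, ha, hb, h⟩ := h
    exact ⟨b, a, hb, ha, fun P => by rw [Finsupp.neg_apply, h, neg_sub]⟩

theorem exists_of_single_mem_principalDivisors {P : HeightOnePrime A} {n : ℕ}
    (h : Finsupp.single P (n : ℤ) ∈ principalDivisors A) :
    ∃ c : A, c ≠ 0 ∧ ∀ Q, (ordAt Q c : ℤ) = Finsupp.single P (n : ℤ) Q := by
  obtain ⟨a, b, ha, hb, hab⟩ := exists_of_mem_principalDivisors h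
  have hnonneg (Q : HeightOnePrime A) : 0 ≤ Finsupp.single P (n : ℤ) Q :=
    Finsupp.single_nonneg.mpr n.cast_nonneg Q
  obtain ⟨c, rfl⟩ : b ∣ a := dvd_of_forall_ordAt_le ha hb fun Q => by
    have := hnonneg Q
    rw [hab] at this
    omega
  have hc : c ≠ 0 := right_ne_zero_of_mul ha
  refine ⟨c, hc, fun Q => ?_⟩
  rw [hab, ordAt_mul Q hb hc]
  push_cast
  ring

theorem HasTorsionDivisorClassGroup.exists_mem_iff (h : HasTorsionDivisorClassGroup A)
    (P : HeightOnePrime A) :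
    ∃ c : A, c ≠ 0 ∧ ∀ Q : HeightOnePrime A, c ∈ Q.1.asIdeal ↔ Q = P := by
  obtain ⟨n, hn, hnP⟩ := isOfFinAddOrder_iff_nsmul_eq_zero.mp
    (h (QuotientAddGroup.mk (Finsupp.single P (1 : ℤ))))
  rw [← QuotientAddGroup.mk_nsmul, QuotientAddGroup.eq_zero_iff, Finsupp.smul_single,
    nsmul_one] at hnP
  obtain ⟨c, hc, hord⟩ := exists_of_single_mem_principalDivisors hnP
  refine ⟨c, hc, fun Q => ?_⟩
  rw [mem_iff_ordAt_pos Q hc, ← Int.natCast_pos, hord]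
  obtain rfl | hQ := eq_or_ne Q P
  · exact iff_of_true (by rwa [Finsupp.single_eq_same, Int.natCast_pos]) rfl
  · exact iff_of_false (by rw [Finsupp.single_eq_of_ne hQ]; exact lt_irrefl 0) hQ

end ClassGroup

/-! ### Fibres of the saturated regular model -/

section Fiber

variable {K : Type*} [Field K]

theorem isSublocalization_of_forall_isDiscreteValuationRing {A B : Subring K} [IsNoetherianRing B]
    [IsIntegrallyClosed B] [IsFractionRing B K]
    (h : ∀ W ∈ affineModel B, IsDiscreteValuationRing W.toSubring → W ∈ affineModel A) :
    IsSublocalization A B := by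
  refine ⟨{M | ∃ P : Ideal A, ∃ _ : P.IsPrime, M = P.primeCompl ∧
    LocalSubring.ofPrime A P ∈ affineModel B ∧
    IsDiscreteValuationRing (LocalSubring.ofPrime A P).toSubring}, ?_, fun x => ⟨?_, ?_⟩⟩
  · rintro M ⟨P, hP, rfl, -⟩ h0
    exact h0 P.zero_mem
  · rintro hx M ⟨P, hP, rfl, hB, -⟩
    exact mem_ofPrime_iff.mp (le_of_mem_affineModel hB hx)
  · intro hx
    refine mem_of_forall_isDiscreteValuationRing fun W hW hWd => ?_
    obtain ⟨P, hP, rfl⟩ := h W hW hWd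
    exact mem_ofPrime_iff.mpr (hx _ ⟨P, hP, rfl, hW, hWd⟩)

section TorsionClassGroup

variable {S T : LocalSubring K} [IsNoetherianRing S.toSubring] [IsIntegrallyClosed S.toSubring]
  [IsNoetherianRing T.toSubring] [IsIntegrallyClosed T.toSubring] [IsFractionRing T.toSubring K]

theorem HasTorsionDivisorClassGroup.mem_affineModel
    (htors : HasTorsionDivisorClassGroup S.toSubring) (hST : S ≤ T)
    (h : ∀ W ∈ affineModel T.toSubring, IsDiscreteValuationRing W.toSubring →
      W ∈ affineModel S.toSubring) {W : LocalSubring K} (hW : W ∈ affineModel S.toSubring)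
    (hWd : IsDiscreteValuationRing W.toSubring) : W ∈ affineModel T.toSubring := by
  obtain ⟨P, hP, rfl⟩ := hW
  let P₁ : HeightOnePrime S.toSubring :=
    ⟨⟨P, hP⟩, height_eq_one_of_isDiscreteValuationRing_ofPrime hWd⟩
  obtain ⟨c, hc0, hc⟩ := htors.exists_mem_iff P₁
  have hcK : (c : K) ≠ 0 := ZeroMemClass.coe_eq_zero.not.mpr hc0
  have hcS : c ∈ maximalIdeal S.toSubring := le_maximalIdeal hP.ne_top ((hc P₁).mpr rfl)
  by_contra hPT
  refine inv_notMem_of_mem_maximalIdeal hST hcS hcK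
    (mem_of_forall_isDiscreteValuationRing fun W' hW' hWd' => ?_)
  obtain ⟨Q, hQ, rfl⟩ := h W' hW' hWd'
  refine (inv_mem_ofPrime_iff hcK).mpr fun hcQ => hPT ?_
  have hQP : ⟨⟨Q, hQ⟩, height_eq_one_of_isDiscreteValuationRing_ofPrime hWd'⟩ = P₁ := (hc _).mp hcQ
  obtain rfl : Q = P := congrArg (fun Q : HeightOnePrime S.toSubring => Q.1.asIdeal) hQP
  exact hW'

theorem HasTorsionDivisorClassGroup.eq_of_le [IsFractionRing S.toSubring K]
    (htors : HasTorsionDivisorClassGroup S.toSubring) (hST : S ≤ T)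
    (h : ∀ W ∈ affineModel T.toSubring, IsDiscreteValuationRing W.toSubring →
      W ∈ affineModel S.toSubring) : T = S :=
  LocalSubring.ext <| le_antisymm
    (fun _ hx => mem_of_forall_isDiscreteValuationRing fun _ hW hWd =>
      le_of_mem_affineModel (htors.mem_affineModel hST h hW hWd) hx) hST.1

end TorsionClassGroup

variable {R : LocalSubring K} {Γ Y : Set (LocalSubring K)} {S T : LocalSubring K}

theorem le_of_mem_saturatedModel (hT : T ∈ saturatedModel R Γ) : R.toSubring ≤ T.toSubring := by
  obtain ⟨N, hN⟩ := hT
  exact le_of_mem_iterate_blowupPoints (hN N le_rfl)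

theorem isRegularLocalRing_of_mem_saturatedModel [IsRegularLocalRing R.toSubring]
    (hT : T ∈ saturatedModel R Γ) : IsRegularLocalRing T.toSubring := by
  obtain ⟨N, hN⟩ := hT
  exact isRegularLocalRing_of_mem_iterate_blowupPoints (hN N le_rfl)

theorem mem_affineModel_of_mem_fiber_saturatedModel [IsFractionRing R.toSubring K]
    [IsNoetherianRing R.toSubring] (hY : IsModel R.toSubring Y)
    (hord : ∀ S ∈ Γ, ∃ V : ValuationSubring K,
      V.toLocalSubring ∈ Y ∧ IsDiscreteValuationRing V ∧ (V : Set K) = ordRing S)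
    (hS : S ∈ Y) (hT : T ∈ fiber (saturatedModel R Γ) S) {W : LocalSubring K}
    (hW : W ∈ affineModel T.toSubring) (hWd : IsDiscreteValuationRing W.toSubring) :
    W ∈ affineModel S.toSubring := by
  obtain ⟨⟨N, hN⟩, hST⟩ := hT
  have hSW : S.toSubring ≤ W.toSubring := hST.1.trans (le_of_mem_affineModel hW)
  obtain h | ⟨V, hV, rfl⟩ := mem_affineModel_or_eq_of_mem_iterate_blowupPoints
    (E := {V | V.toLocalSubring ∈ Y ∧ IsDiscreteValuationRing V}) (fun V hV => hV.2)
    (fun S hS => (hord S hS).imp fun V hV => ⟨⟨hV.1, hV.2.1⟩, hV.2.2⟩) (hN N le_rfl) hW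
  · exact mem_affineModel_of_le h (hY.le hS) hSW
  · exact hY.mem_affineModel_of_le hS hV.1 hSW

theorem IsModel.nonempty_fiber_saturatedModel [IsRegularLocalRing R.toSubring]
    (hY : IsModel R.toSubring Y) (hfin : Γ.Finite) (hd : ∀ S ∈ Γ, 2 ≤ ringKrullDim S.toSubring)
    (hg : HasMorphism (saturatedModel R Γ) Y) (hS : S ∈ Y) :
    (fiber (saturatedModel R Γ) S).Nonempty := by
  obtain ⟨V, hSV⟩ := LocalSubring.exists_le_valuationSubring S
  have hRV : R.toSubring ≤ V.toSubring := (hY.le hS).trans hSV.1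
  obtain ⟨T, hT, hTV⟩ := exists_mem_saturatedModel_le hfin hd hRV
  obtain ⟨S', hS', hST⟩ := hg T hT
  obtain rfl := hY.irredundant V hRV S' hS' S hS (hST.trans hTV) hSV
  exact ⟨T, hT, hST⟩

end Fiber

end ZariskiModel

theorem theorem3p10_general {K : Type*} [Field K] (R : LocalSubring K)
    [IsFractionRing R.toSubring K] [IsRegularLocalRing R.toSubring]
    (Γ : Set (LocalSubring K)) (hfin : Γ.Finite) (hdim : ∀ S ∈ Γ, 2 ≤ ringKrullDim S.toSubring)
    (Y : Set (LocalSubring K)) (hY : IsModel R.toSubring Y) (hYn : IsNormalModel Y)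
    (hg : HasMorphism (saturatedModel R Γ) Y)
    (hord : ∀ S ∈ Γ, ∃ V : ValuationSubring K,
      V.toLocalSubring ∈ Y ∧ IsDiscreteValuationRing V ∧ (V : Set K) = ordRing S) :
    (∀ S ∈ Y, ∀ T ∈ fiber (saturatedModel R Γ) S, IsSublocalization S.toSubring T.toSubring) ∧
    (∀ S ∈ Y, HasTorsionDivisorClassGroup S.toSubring → IsBiregularAt (saturatedModel R Γ) S) ∧
    (∀ S ∈ Y, ¬ IsRegularLocalRing S.toSubring →
      ¬ HasTorsionDivisorClassGroup S.toSubring) := by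
  have hreg {T} (hT : T ∈ saturatedModel R Γ) := isRegularLocalRing_of_mem_saturatedModel hT
  have hfrac {T} (hT : T ∈ saturatedModel R Γ) : IsFractionRing T.toSubring K :=
    isFractionRing_of_le (le_of_mem_saturatedModel hT)
  have hDVR {S} (hS : S ∈ Y) {T} (hT : T ∈ fiber (saturatedModel R Γ) S) :=
    fun W => mem_affineModel_of_mem_fiber_saturatedModel hY hord hS hT (W := W)
  have hbireg {S} (hS : S ∈ Y) (htors : HasTorsionDivisorClassGroup S.toSubring) :
      IsBiregularAt (saturatedModel R Γ) S := by
    have := hY.isNoetherianRing hS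
    have := hYn S hS
    have : IsFractionRing S.toSubring K := isFractionRing_of_le (hY.le hS)
    have hne := hY.nonempty_fiber_saturatedModel hfin hdim hg hS
    refine hne.subset_singleton_iff.mp fun T hT => ?_
    have := hreg hT.1
    have := hfrac hT.1
    exact htors.eq_of_le hT.2 (hDVR hS hT)
  refine ⟨fun S hS T hT => ?_, fun S => hbireg, fun S hS hnreg htors => hnreg ?_⟩
  · have := hreg hT.1
    have := hfrac hT.1
    exact isSublocalization_of_forall_isDiscreteValuationRing (hDVR hS hT)
  · exact hreg ((hbireg hS htors).ge rfl).1

theorem theorem3p10 {K : Type*} [Field K] (R : LocalSubring K)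
    [IsFractionRing R.toSubring K] [IsRegularLocalRing R.toSubring]
    (hdim : 2 ≤ ringKrullDim R.toSubring)
    (I : Ideal R.toSubring) (hI : I.radical = maximalIdeal R.toSubring)
    (hfin : (basePoints R I).Finite)
    (Y : Set (LocalSubring K)) (hY : IsCompleteModel R.toSubring Y) (hYn : IsNormalModel Y)
    (hg : HasMorphism (saturatedModel R (basePoints R I)) Y)
    (hh : HasMorphism Y (normalizedBlowup R.toSubring I))
    (hord : ∀ S ∈ basePoints R I,
      ∃ V ∈ reesValuationRings R.toSubring I, (V : Set K) = ordRing S) :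
    (∀ S ∈ Y, ∀ T ∈ fiber (saturatedModel R (basePoints R I)) S,
      IsSublocalization S.toSubring T.toSubring) ∧
    (∀ S ∈ Y, HasTorsionDivisorClassGroup S.toSubring →
      IsBiregularAt (saturatedModel R (basePoints R I)) S) ∧
    (∀ S ∈ Y, ¬ IsRegularLocalRing S.toSubring →
      ¬ HasTorsionDivisorClassGroup S.toSubring) := by
  have hrees := hY.reesValuationRings_subset hYn hh
  exact theorem3p10_general R _ hfin (fun S hS => hS.1.two_le_dim) Y hY.toIsModel hYn hg
    fun S hS => (hord S hS).imp fun V hV => ⟨(hrees hV.1).1, (hrees hV.1).2.1, hV.2⟩
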